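/- Let $\lambda_q=2^q$ and fix a nonnegative radial function $\chi\in C_0^\infty(B(0,1))$ on $\mathbb R^3$ with $\chi(\xi)=1$ for $|\xi|\le 1/2$; put $\varphi(\xi)=\chi(\xi/2)-\chi(\xi)$. With $\mathcal F f(\xi)=\int_{\mathbb R^3} f(x)e^{-ix\cdot\xi}\,dx$, let $h=\mathcal F^{-1}\varphi$, $\tilde h=\mathcal F^{-1}\chi$, and define $$\Delta_q f(x)=\lambda_q^3\int_{\mathbb R^3} h(\lambda_q y)f(x-y)\,dy\ (q\ge 0),\qquad \Delta_{-1}f(x)=\int_{\mathbb R^3}\tilde h(y)f(x-y)\,dy,\qquad S_Q=\sum_{q=-1}^{Q}\Delta_q .$$ For a vector field $u\in L^2(\mathbb R^3;\mathbb R^3)$ which is divergence-free in the sense of distributions, let $$\Pi_Q=\int_{\mathbb R^3}\mathrm{Tr}\,[S_Q(u\otimes u)\cdot\nabla S_Q u]\,dx\quad(Q\in\mathbb N=\{0,1,2,\dots\}),\qquad d_q=\lambda_q^{1/3}\|\Delta_q u\|_{L^3}\quad(q\ge -1),$$ $$K(q)=\lambda_q^{2/3}\ \text{ for } q\le 0,\qquad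 K(q)=\lambda_q^{-4/3}\ \text{ for } q>0,\qquad (K*d^2)(Q)=\sum_{p\ge -1}K(Q-p)\,d_p^2\in[0,\infty].$$ Then there is a constant $C>0$, depending only on $\chi$, such that for every divergence-free $u\in L^2(\mathbb R^3;\mathbb R^3)$ and every $Q\in\mathbb N$, the field $S_Qu$ is differentiable, the integral defining $\Pi_Q$ converges absolutely, and $$|\Pi_Q|\le C\,\bigl((K*d^2)(Q)\bigr)^{3/2}.$$ -/

import Mathlib

open MeasureTheory Real
open scoped ENNReal FourierTransform Convolution ContDiff RealInnerProductSpace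

noncomputable section

namespace LittlewoodPaley

/-- The space `ℝ³` with its Euclidean norm. -/
abbrev E3 : Type := EuclideanSpace ℝ (Fin 3)

/-- The dyadic wave number `λ_q = 2 ^ q`. -/
def lam (q : ℤ) : ℝ := (2 : ℝ) ^ q

/-- A radial nonnegative `χ ∈ C₀^∞(B(0,1))` with `χ(ξ) = 1` for `|ξ| ≤ 1/2`. -/
structure IsCutoff (χ : E3 → ℝ) : Prop where
  smooth : ContDiff ℝ ∞ χ
  support : tsupport χ ⊆ Metric.ball 0 1
  nonneg : ∀ ξ, 0 ≤ χ ξ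
  radial : ∀ ξ η, ‖ξ‖ = ‖η‖ → χ ξ = χ η
  eq_one : ∀ ξ, ‖ξ‖ ≤ 1 / 2 → χ ξ = 1

/-- The shell profile `φ(ξ) = χ(λ₁⁻¹ ξ) - χ(ξ)`. -/
def shell (χ : E3 → ℝ) (ξ : E3) : ℝ := χ ((lam 1)⁻¹ • ξ) - χ ξ

/-- The inverse Fourier transform in the angular convention,
`(𝓕⁻¹ g)(y) = (2π)⁻³ ∫ e^{i y·ξ} g(ξ) dξ` (see `invFourierC_eq`). -/
def invFourierC (g : E3 → ℝ) (y : E3) : ℂ :=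
  (((2 * π) ^ 3)⁻¹ : ℝ) * 𝓕⁻ (fun ξ => (g ξ : ℂ)) ((2 * π)⁻¹ • y)

theorem invFourierC_eq (g : E3 → ℝ) (y : E3) :
    invFourierC g y =
      (((2 * π) ^ 3)⁻¹ : ℝ) * ∫ ξ : E3, Complex.exp (Complex.I * (⟪y, ξ⟫ : ℝ)) * (g ξ : ℂ) := by
  have hpi : (2 * π) ≠ 0 := by positivity
  rw [invFourierC, Real.fourierInv_eq']
  congr 1
  refine integral_congr_ae (Filter.Eventually.of_forall fun ξ => ?_)
  have h : 2 * π * ⟪ξ, (2 * π)⁻¹ • y⟫ = ⟪y, ξ⟫ := by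
    rw [real_inner_smul_right, ← mul_assoc, mul_inv_cancel₀ hpi, one_mul, real_inner_comm]
  simp only [h, smul_eq_mul]
  rw [mul_comm Complex.I]

/-- The inverse Fourier transform as a real-valued function. It is used for radial `g` only, where
`invFourierC g` is real (see `ofReal_invFourier`). -/
def invFourier (g : E3 → ℝ) (y : E3) : ℝ := (invFourierC g y).re

theorem ofReal_invFourier (g : E3 → ℝ) (hg : ∀ ξ η, ‖ξ‖ = ‖η‖ → g ξ = g η) (y : E3) :
    (invFourier g y : ℂ) = invFourierC g y := by
  rw [invFourier, ← Complex.conj_eq_iff_re]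
  rw [invFourierC_eq, map_mul, Complex.conj_ofReal, ← integral_conj]
  congr 1
  rw [← integral_neg_eq_self]
  refine integral_congr_ae (Filter.Eventually.of_forall fun ξ => ?_)
  have h : g (-ξ) = g ξ := hg _ _ (norm_neg ξ)
  simp [h, ← Complex.exp_conj]

/-- The convolution kernel of `Δ_q`: `h̃ = 𝓕⁻¹ χ` for `q = -1`, and `y ↦ λ_q³ h(λ_q y)` with
`h = 𝓕⁻¹ φ` for `q ≥ 0`. There is no block with `q < -1`, and the kernel is `0` there. -/
def kernel (χ : E3 → ℝ) (q : ℤ) (y : E3) : ℝ :=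
  if 0 ≤ q then lam q ^ 3 * invFourier (shell χ) (lam q • y)
  else if q = -1 then invFourier χ y
  else 0

/-- The Littlewood-Paley block `(Δ_q f)(x) = ∫ kernel_q(y) f(x - y) dy`, for functions with values
in any real normed space. -/
def block {F : Type*} [NormedAddCommGroup F] [NormedSpace ℝ F]
    (χ : E3 → ℝ) (q : ℤ) (f : E3 → F) : E3 → F :=
  kernel χ q ⋆[ContinuousLinearMap.lsmul ℝ ℝ, volume] f

/-- The partial sum `S_Q = ∑_{q=-1}^Q Δ_q`. -/
def partialSum {F : Type*} [NormedAddCommGroup F] [NormedSpace ℝ F]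
    (χ : E3 → ℝ) (Q : ℤ) (f : E3 → F) (x : E3) : F :=
  ∑ q ∈ Finset.Icc (-1) Q, block χ q f x

/-- `∇ · u = 0` in the sense of distributions. -/
def IsDivFree (u : E3 → E3) : Prop :=
  ∀ ψ : E3 → ℝ, ContDiff ℝ ∞ ψ → HasCompactSupport ψ → ∫ x, fderiv ℝ ψ x (u x) = 0

/-- The matrix `S_Q (u ⊗ u) (x)`. -/
def tensorMatrix (χ : E3 → ℝ) (Q : ℤ) (u : E3 → E3) (x : E3) : Matrix (Fin 3) (Fin 3) ℝ :=
  Matrix.of fun i j => partialSum χ Q (fun z => u z i * u z j) x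

/-- The gradient matrix `(∂_i v_j (x))_{i,j}` of a vector field. -/
def gradMatrix (v : E3 → E3) (x : E3) : Matrix (Fin 3) (Fin 3) ℝ :=
  Matrix.of fun i j => fderiv ℝ v x (EuclideanSpace.single i 1) j

/-- The integrand `Tr [S_Q (u ⊗ u) · ∇ S_Q u]` of the energy flux. -/
def fluxDensity (χ : E3 → ℝ) (Q : ℤ) (u : E3 → E3) (x : E3) : ℝ :=
  (tensorMatrix χ Q u x * gradMatrix (partialSum χ Q u) x).trace

/-- The energy flux `Π_Q`. -/
def flux (χ : E3 → ℝ) (Q : ℤ) (u : E3 → E3) : ℝ := ∫ x, fluxDensity χ Q u x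

/-- `d_q = λ_q^{1/3} ‖Δ_q u‖₃`, extended by `0` to `q < -1`. -/
def dcoef (χ : E3 → ℝ) (u : E3 → E3) (q : ℤ) : ℝ≥0∞ :=
  ENNReal.ofReal (lam q ^ (1 / 3 : ℝ)) * eLpNorm (block χ q u) 3 volume

/-- The localization kernel `K`. -/
def locKernel (q : ℤ) : ℝ :=
  if q ≤ 0 then lam q ^ (2 / 3 : ℝ) else lam q ^ (-(4 / 3) : ℝ)

/-- `(K * d²)(Q) = ∑_p K(Q - p) d_p²`, a number in `[0, ∞]`; the terms with `p < -1` vanish. -/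
def locConv (χ : E3 → ℝ) (u : E3 → E3) (Q : ℤ) : ℝ≥0∞ :=
  ∑' p : ℤ, ENNReal.ofReal (locKernel (Q - p)) * dcoef χ u p ^ 2

end LittlewoodPaley

end

/-! Write S for S_Q u, k for the kernel of S_Q, and L for (K * d²)(Q). Since k has integral 1, S_Q(u
⊗ u)(x) equals S(x) ⊗ S(x) plus the covariance ∫ k(y) w_y(x) ⊗ w_y(x) dy, where w_y(x) = u(x - y) -
S(x) (`lowPass_mul_sub`). The first term contributes ½ ∫ S · ∇|S|² to the flux, which vanishes
because S inherits the divergence-free condition (`integral_inner_lowPass_eq_zero`). In the second,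
Hölder's inequality in L³ applies with ‖w_y‖₃ ≤ A + D|y|. Here A bounds ‖u - S‖₃, and D is a
Lipschitz constant of y ↦ S(· + y) in L³, which also bounds each ∂_j S. The zeroth and second
moments of |k| then give |Π_Q| ≲ D (A² + D²/λ_Q²) (`exists_abs_flux_le_of_bounds`).

It remains to see that A ≲ λ_Q^{-1/3} √L and D ≲ λ_Q^{2/3} √L. The terms of L are λ_Q^{2/3} ‖Δ_q
u‖₃² for q ≥ Q and λ_Q^{-4/3} λ_q² ‖Δ_q u‖₃² for q < Q. There is no spare geometric decay, so
summing L³ norms of blocks by the triangle inequality is too weak. What is needed is an ℓ² bound,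
the embedding of B⁰_{3,2} into L³ (`exists_nrm3_lowPass_sub_le`); for D it is applied to translation
differences of u.

The embedding is proved without square functions, by telescoping the cube of the L³ norm over
partial sums g_n. Adding a block f costs 3 ∫ |g| g · f plus terms quadratic and cubic in f. As f is
a mean-zero kernel convolved with three neighbouring blocks, the cross term gains 2^{-n} times the
L³ Lipschitz constant of g_n (`abs_integral_inner_convolution_le`), that is, a geometric average of
the earlier block norms. Such averages are bounded on ℓ², and `sq_le_sum_of_cube_le` closes the
recursion. -/

open scoped SchwartzMap Topology
open Filter

noncomputable section

namespace LittlewoodPaley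

/-! ### Low-pass kernels: multipliers, dilation and moments -/

/-- The kernel `t³ h̃(t y)` of the low-pass filter at frequency `t`. -/
def dil (χ : E3 → ℝ) (t : ℝ) (y : E3) : ℝ := t ^ 3 * invFourier χ (t • y)

theorem IsCutoff.hasCompactSupport {χ : E3 → ℝ} (hχ : IsCutoff χ) : HasCompactSupport χ :=
  (isCompact_closedBall (0 : E3) 1).of_isClosed_subset (isClosed_tsupport χ)
    (hχ.support.trans Metric.ball_subset_closedBall)

theorem IsCutoff.eq_zero {χ : E3 → ℝ} (hχ : IsCutoff χ) {ξ : E3} (h : 1 ≤ ‖ξ‖) : χ ξ = 0 := by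
  by_contra h0
  have := hχ.support (subset_tsupport χ h0)
  rw [mem_ball_zero_iff] at this
  linarith

/-- The factor 2π/t combines the dilation by t with the passage from the angular convention to the
kernel e^{-2πi⟨x, ξ⟩} of `𝓕`. All multiplier identities are then computed on Schwartz functions. -/
theorem exists_frequency_cutoff {χ : E3 → ℝ} (hχ : IsCutoff χ) {t : ℝ} (ht : 0 < t) :
    ∃ g : 𝓢(E3, ℂ), ∀ ξ, g ξ = χ ((2 * π / t) • ξ) := by
  have hR : 2 * π / t ≠ 0 := by positivity
  have h1 : ContDiff ℝ ∞ (fun ξ : E3 => (χ ((2 * π / t) • ξ) : ℂ)) :=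
    Complex.ofRealCLM.contDiff.comp (hχ.smooth.comp (contDiff_const_smul _))
  have h2 : HasCompactSupport (fun ξ : E3 => (χ ((2 * π / t) • ξ) : ℂ)) :=
    (hχ.hasCompactSupport.comp_smul hR).comp_left (g := fun x : ℝ => (x : ℂ)) Complex.ofReal_zero
  exact ⟨h2.toSchwartzMap h1, fun ξ => rfl⟩

theorem ofReal_dil {χ : E3 → ℝ} (hχ : IsCutoff χ) {t : ℝ} (ht : 0 < t) {g : 𝓢(E3, ℂ)}
    (hg : ∀ ξ, g ξ = χ ((2 * π / t) • ξ)) (y : E3) : (dil χ t y : ℂ) = 𝓕⁻ g y := by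
  have hpi : (π : ℂ) ≠ 0 := Complex.ofReal_ne_zero.2 pi_ne_zero
  have htc : (t : ℂ) ≠ 0 := Complex.ofReal_ne_zero.2 ht.ne'
  rw [dil, Complex.ofReal_mul, ofReal_invFourier χ hχ.radial, invFourierC,
    SchwartzMap.fourierInv_coe, Real.fourierInv_eq', Real.fourierInv_eq']
  have h := Measure.integral_comp_smul (volume : Measure E3)
    (fun η : E3 => Complex.exp (↑(2 * π * ⟪η, (t / (2 * π)) • y⟫) * Complex.I) • (χ η : ℂ))
    (2 * π / t)
  have h1 : ∀ ξ : E3, ⟪(2 * π / t) • ξ, (t / (2 * π)) • y⟫ = ⟪ξ, y⟫ := fun ξ => by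
    rw [real_inner_smul_left, real_inner_smul_right]
    field_simp
  simp only [h1] at h
  simp only [hg]
  rw [h]
  have h2 : (2 * π)⁻¹ • t • y = (t / (2 * π)) • y := by
    rw [smul_smul]; congr 1; field_simp
  rw [h2, finrank_euclideanSpace, Fintype.card_fin, abs_of_pos (by positivity), Complex.real_smul,
    ← mul_assoc]
  congr 1
  push_cast
  field_simp

theorem exists_schwartz_dil {χ : E3 → ℝ} (hχ : IsCutoff χ) {t : ℝ} (ht : 0 < t) :
    ∃ k : 𝓢(E3, ℝ), ⇑k = dil χ t := by
  obtain ⟨g, hg⟩ := exists_frequency_cutoff hχ ht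
  refine ⟨SchwartzMap.postcompCLM (𝕜 := ℝ) Complex.reCLM (𝓕⁻ g), ?_⟩
  ext y
  rw [SchwartzMap.postcompCLM_apply, ← ofReal_dil hχ ht hg]
  simp

/-- The total mass is the multiplier at frequency 0, namely χ(0) = 1. -/
theorem integral_dil {χ : E3 → ℝ} (hχ : IsCutoff χ) {t : ℝ} (ht : 0 < t) :
    ∫ y, dil χ t y = 1 := by
  obtain ⟨g, hg⟩ := exists_frequency_cutoff hχ ht
  have h1 : (∫ y, (dil χ t y : ℂ)) = 1 := by
    simp only [ofReal_dil hχ ht hg]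
    have h2 : 𝓕 (𝓕⁻ g) (0 : E3) = 1 := by
      rw [FourierTransform.fourier_fourierInv_eq, hg, smul_zero, hχ.eq_one 0 (by simp)]
      simp
    rw [← h2, SchwartzMap.fourier_coe, Real.fourier_eq']
    simp
  rw [integral_complex_ofReal] at h1
  exact_mod_cast h1

/-- Where χ(ξ/t) is nonzero, |ξ| < t ≤ s/2, so χ(ξ/s) = 1 and the product of the two multipliers is
the first one. -/
theorem dil_convolution_dil {χ : E3 → ℝ} (hχ : IsCutoff χ) {s t : ℝ} (ht : 0 < t)
    (hst : 2 * t ≤ s) :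
    dil χ t ⋆[ContinuousLinearMap.lsmul ℝ ℝ, volume] dil χ s = dil χ t := by
  have hs : 0 < s := by linarith
  obtain ⟨g, hg⟩ := exists_frequency_cutoff hχ ht
  obtain ⟨g', hg'⟩ := exists_frequency_cutoff hχ hs
  ext x
  have h := SchwartzMap.convolution_apply (ContinuousLinearMap.mul ℂ ℂ) (𝓕⁻ g) (𝓕⁻ g') x
  have h1 : SchwartzMap.convolution (ContinuousLinearMap.mul ℂ ℂ) (𝓕⁻ g) (𝓕⁻ g') = 𝓕⁻ g := by
    have h2 : SchwartzMap.pairing (ContinuousLinearMap.mul ℂ ℂ) g g' = g := by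
      ext ξ
      rw [SchwartzMap.pairing_apply_apply, ContinuousLinearMap.mul_apply', hg, hg']
      by_cases hξ : 1 ≤ ‖(2 * π / t) • ξ‖
      · rw [hχ.eq_zero hξ]; simp
      · have : ‖(2 * π / s) • ξ‖ ≤ 1 / 2 := by
          rw [norm_smul, Real.norm_of_nonneg (by positivity)] at *
          push Not at hξ
          rw [div_mul_eq_mul_div, div_lt_one ht] at hξ
          rw [div_mul_eq_mul_div, div_le_iff₀ hs]
          linarith
        rw [hχ.eq_one _ this]; simp
    have h3 : SchwartzMap.convolution (ContinuousLinearMap.mul ℂ ℂ) (𝓕⁻ g) (𝓕⁻ g') =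
        𝓕⁻ (SchwartzMap.pairing (ContinuousLinearMap.mul ℂ ℂ) g g') := by
      simp [SchwartzMap.convolution]
    rw [h3, h2]
  rw [h1, ← ofReal_dil hχ ht hg] at h
  apply Complex.ofReal_injective
  rw [h, convolution_def, convolution_def, ← integral_complex_ofReal]
  refine integral_congr_ae (Eventually.of_forall fun y => ?_)
  simp [← ofReal_dil hχ ht hg, ← ofReal_dil hχ hs hg']

theorem integral_comp_smul_E3 {F : Type*} [NormedAddCommGroup F] [NormedSpace ℝ F] (f : E3 → F)
    {t : ℝ} (ht : 0 < t) : ∫ y, f (t • y) = (t ^ 3)⁻¹ • ∫ y, f y := by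
  rw [Measure.integral_comp_smul, finrank_euclideanSpace, Fintype.card_fin,
    abs_of_pos (by positivity)]

theorem dil_one_smul (χ : E3 → ℝ) (t : ℝ) (y : E3) : dil χ t y = t ^ 3 * dil χ 1 (t • y) := by
  simp [dil]

theorem integrable_dil {χ : E3 → ℝ} (hχ : IsCutoff χ) {t : ℝ} (ht : 0 < t) :
    Integrable (dil χ t) := by
  obtain ⟨k, hk⟩ := exists_schwartz_dil hχ ht
  rw [← hk]; exact k.integrable

theorem integrable_pow_mul_dil {χ : E3 → ℝ} (hχ : IsCutoff χ) {t : ℝ} (ht : 0 < t) (n : ℕ) :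
    Integrable (fun y => ‖y‖ ^ n * |dil χ t y|) := by
  obtain ⟨k, hk⟩ := exists_schwartz_dil hχ ht
  rw [← hk]; exact k.integrable_pow_mul volume n

theorem integral_pow_mul_dil (χ : E3 → ℝ) {t : ℝ} (ht : 0 < t) (n : ℕ) :
    ∫ y, ‖y‖ ^ n * |dil χ t y| = (∫ y, ‖y‖ ^ n * |dil χ 1 y|) / t ^ n := by
  have h := integral_comp_smul_E3 (fun y => ‖y‖ ^ n * |dil χ 1 y|) ht
  have h1 : ∀ y, ‖y‖ ^ n * |dil χ t y| = t ^ 3 / t ^ n * (‖t • y‖ ^ n * |dil χ 1 (t • y)|) :=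
    fun y => by
      rw [dil_one_smul, abs_mul, abs_of_pos (by positivity), norm_smul, Real.norm_of_nonneg ht.le,
        mul_pow]
      field_simp
  simp only [h1]
  rw [integral_const_mul, h, smul_eq_mul]
  field_simp

/-- `L¹` modulus of continuity of a Schwartz function. -/
theorem integral_norm_translate_sub_le (k : 𝓢(E3, ℝ)) (y : E3) :
    ∫ x, ‖k (x + y) - k x‖ ≤ (∫ x, ‖fderiv ℝ k x‖) * ‖y‖ := by
  have hD : Integrable (fun x => fderiv ℝ k x) := (SchwartzMap.fderivCLM ℝ E3 ℝ k).integrable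
  have hDc : Continuous (fun x => fderiv ℝ k x) := (SchwartzMap.fderivCLM ℝ E3 ℝ k).continuous
  have hi : Integrable (Function.uncurry fun (s : ℝ) (x : E3) => ‖fderiv ℝ k (x + s • y)‖ * ‖y‖)
      ((volume.restrict (Set.Ioc 0 1)).prod volume) := by
    rw [integrable_prod_iff (by
      refine Continuous.aestronglyMeasurable ?_
      simp only [Function.uncurry_def]
      fun_prop)]
    constructor
    · exact Eventually.of_forall fun s => (hD.norm.comp_add_right (s • y)).mul_const _
    · simp only [Function.uncurry_apply_pair, norm_mul, norm_norm]
      have : ∀ s : ℝ, ∫ x, ‖fderiv ℝ k (x + s • y)‖ * ‖y‖ = (∫ x, ‖fderiv ℝ k x‖) * ‖y‖ := by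
        intro s
        rw [integral_mul_const, integral_add_right_eq_self (fun x => ‖fderiv ℝ k x‖)]
      simp only [this]
      exact integrable_const _
  calc ∫ x, ‖k (x + y) - k x‖
      -- The increment is the integral of the derivative along the segment from x to x + y;
      -- exchanging the integrals and translation invariance then remove the shift.
      ≤ ∫ x, ∫ s in Set.Ioc (0:ℝ) 1, ‖fderiv ℝ k (x + s • y)‖ * ‖y‖ := by
        refine integral_mono ((k.integrable.comp_add_right y).sub k.integrable).norm
          hi.swap.integral_prod_left fun x => ?_
        have hd : ∀ s : ℝ, HasDerivAt (fun s : ℝ => k (x + s • y))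
            (fderiv ℝ k (x + s • y) y) s := by
          intro s
          have h1 : HasDerivAt (fun s : ℝ => x + s • y) y s := by
            simpa using ((hasDerivAt_id s).smul_const y).const_add x
          exact (k.hasFDerivAt _).comp_hasDerivAt s h1
        have hc : Continuous fun s : ℝ => fderiv ℝ k (x + s • y) y := by fun_prop
        have h := intervalIntegral.integral_eq_sub_of_hasDerivAt (a := 0) (b := 1)
          (fun s _ => hd s) (hc.intervalIntegrable _ _)
        simp only [one_smul, zero_smul, add_zero] at h
        dsimp only
        rw [← h, intervalIntegral.integral_of_le zero_le_one]
        refine (norm_integral_le_integral_norm _).trans ?_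
        refine integral_mono_of_nonneg (Eventually.of_forall fun s => norm_nonneg _) ?_
          (Eventually.of_forall fun s => ContinuousLinearMap.le_opNorm _ _)
        have hc2 : Continuous fun s : ℝ => ‖fderiv ℝ k (x + s • y)‖ * ‖y‖ := by fun_prop
        exact (hc2.intervalIntegrable 0 1).1
    _ = ∫ s in Set.Ioc (0:ℝ) 1, ∫ x, ‖fderiv ℝ k (x + s • y)‖ * ‖y‖ :=
        (integral_integral_swap hi).symm
    _ = (∫ x, ‖fderiv ℝ k x‖) * ‖y‖ := by
        have : ∀ s : ℝ, ∫ x, ‖fderiv ℝ k (x + s • y)‖ * ‖y‖ = (∫ x, ‖fderiv ℝ k x‖) * ‖y‖ := by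
          intro s
          rw [integral_mul_const, integral_add_right_eq_self (fun x => ‖fderiv ℝ k x‖)]
        simp [this]

/-- Uniform bounds for all dilated kernels. -/
theorem exists_dil_bounds {χ : E3 → ℝ} (hχ : IsCutoff χ) :
    ∃ C : ℝ, 0 < C ∧ ∀ t : ℝ, 0 < t →
      (∫ y, |dil χ t y|) ≤ C ∧ (∫ y, ‖y‖ * |dil χ t y|) ≤ C / t ∧
      (∫ y, ‖y‖ ^ 2 * |dil χ t y|) ≤ C / t ^ 2 ∧
      ∀ y, ∫ x, |dil χ t (x + y) - dil χ t x| ≤ C * t * ‖y‖ := by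
  obtain ⟨k, hk⟩ := exists_schwartz_dil hχ one_pos
  have n0 : 0 ≤ ∫ y, ‖y‖ ^ 0 * |dil χ 1 y| := integral_nonneg fun y => by positivity
  have n1 : 0 ≤ ∫ y, ‖y‖ ^ 1 * |dil χ 1 y| := integral_nonneg fun y => by positivity
  have n2 : 0 ≤ ∫ y, ‖y‖ ^ 2 * |dil χ 1 y| := integral_nonneg fun y => by positivity
  have n3 : 0 ≤ ∫ x, ‖fderiv ℝ k x‖ := integral_nonneg fun y => by positivity
  set I0 := ∫ y, ‖y‖ ^ 0 * |dil χ 1 y|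
  set I1 := ∫ y, ‖y‖ ^ 1 * |dil χ 1 y|
  set I2 := ∫ y, ‖y‖ ^ 2 * |dil χ 1 y|
  set I3 := ∫ x, ‖fderiv ℝ k x‖
  -- By scaling, each bound reduces to t = 1; the summand 1 only makes the constant positive.
  refine ⟨I0 + I1 + I2 + I3 + 1, by positivity, fun t ht => ⟨?_, ?_, ?_, fun y => ?_⟩⟩
  · have := integral_pow_mul_dil χ ht 0
    simp only [pow_zero, one_mul, div_one] at this n0
    rw [this]
    simp only [I0, pow_zero, one_mul]
    linarith
  · have := integral_pow_mul_dil χ ht 1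
    simp only [pow_one] at this
    rw [this]
    gcongr
    have : (∫ y, ‖y‖ * |dil χ 1 y|) = I1 := by simp [I1]
    linarith
  · rw [integral_pow_mul_dil χ ht 2]
    gcongr
    simp only [I2] at *
    linarith
  · have h := integral_comp_smul_E3 (fun x => |dil χ 1 (x + t • y) - dil χ 1 x|) ht
    have h1 : ∀ x, |dil χ t (x + y) - dil χ t x| =
        t ^ 3 * |dil χ 1 (t • x + t • y) - dil χ 1 (t • x)| := fun x => by
      rw [dil_one_smul, dil_one_smul χ t x, ← mul_sub, abs_mul, abs_of_pos (by positivity),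
        smul_add]
    simp only [h1]
    rw [integral_const_mul, h, smul_eq_mul, ← mul_assoc, mul_inv_cancel₀ (by positivity), one_mul]
    have h2 := integral_norm_translate_sub_le k (t • y)
    rw [hk] at h2
    simp only [Real.norm_eq_abs] at h2
    refine h2.trans ?_
    rw [norm_smul, Real.norm_of_nonneg ht.le, ← hk, ← mul_assoc]
    gcongr
    simp only [I3] at *
    linarith

/-! ### Blocks as differences of low-pass kernels -/

/-- The kernels of the partial sums: `S_Q` is convolution with `lowKernel χ (Q + 2)`. -/
def lowKernel (χ : E3 → ℝ) : ℕ → E3 → ℝ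
  | 0 => 0
  | n + 1 => dil χ (2 ^ n)

theorem lowKernel_succ (χ : E3 → ℝ) (n : ℕ) : lowKernel χ (n + 1) = dil χ (2 ^ n) := rfl

theorem invFourier_shell {χ : E3 → ℝ} (hχ : IsCutoff χ) (y : E3) :
    invFourier (shell χ) y = 8 * invFourier χ ((2 : ℝ) • y) - invFourier χ y := by
  have hc : ∀ (g : E3 → ℝ), HasCompactSupport g → Continuous g → ∀ z : E3,
      Integrable fun ξ : E3 => Complex.exp (Complex.I * (⟪z, ξ⟫ : ℝ)) * (g ξ : ℂ) := by
    intro g hg hgc z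
    refine Continuous.integrable_of_hasCompactSupport (by fun_prop) ?_
    exact (hg.comp_left (g := fun x : ℝ => (x : ℂ)) Complex.ofReal_zero).mul_left
  have hχ2 : HasCompactSupport fun ξ => χ ((lam 1)⁻¹ • ξ) :=
    hχ.hasCompactSupport.comp_smul (by simp [lam])
  have hχc : Continuous χ := hχ.smooth.continuous
  have key : invFourierC (shell χ) y = 8 * invFourierC χ ((2 : ℝ) • y) - invFourierC χ y := by
    rw [invFourierC_eq, invFourierC_eq, invFourierC_eq]
    have h1 : ∀ ξ : E3, Complex.exp (Complex.I * (⟪y, ξ⟫ : ℝ)) * (shell χ ξ : ℂ) =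
        Complex.exp (Complex.I * (⟪y, ξ⟫ : ℝ)) * (χ ((lam 1)⁻¹ • ξ) : ℂ) -
          Complex.exp (Complex.I * (⟪y, ξ⟫ : ℝ)) * (χ ξ : ℂ) := fun ξ => by
      rw [shell]; push_cast; ring
    simp only [h1]
    rw [integral_sub (hc _ hχ2 (by fun_prop) y) (hc _ hχ.hasCompactSupport hχc y)]
    have h2 := integral_comp_smul_E3
      (fun ξ : E3 => Complex.exp (Complex.I * (⟪(2 : ℝ) • y, ξ⟫ : ℝ)) * (χ ξ : ℂ))
      (t := 1 / 2) (by norm_num)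
    have h3 : ∀ ξ : E3, ⟪(2 : ℝ) • y, (1 / 2 : ℝ) • ξ⟫ = ⟪y, ξ⟫ := fun ξ => by
      rw [real_inner_smul_left, real_inner_smul_right]; ring
    have h4 : (lam 1)⁻¹ = 1 / 2 := by simp [lam]
    simp only [h3] at h2
    rw [h4, h2, Complex.real_smul]
    push_cast
    ring
  simp only [invFourier, key]
  simp

/-- Setting `lowKernel χ 0 = 0` lets the block q = -1, which is itself a low-pass filter, obey the
same difference formula as the others. Partial sums then telescope. -/
theorem kernel_eq_lowKernel_sub {χ : E3 → ℝ} (hχ : IsCutoff χ) (n : ℕ) :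
    kernel χ ((n : ℤ) - 1) = lowKernel χ (n + 1) - lowKernel χ n := by
  ext y
  rcases n with _ | n
  · simp [kernel, lowKernel, dil]
  · have h0 : (0 : ℤ) ≤ ((n + 1 : ℕ) : ℤ) - 1 := by push_cast; omega
    have h1 : lam (((n + 1 : ℕ) : ℤ) - 1) = 2 ^ n := by
      have : (((n + 1 : ℕ) : ℤ) - 1) = n := by push_cast; ring
      rw [this, lam, zpow_natCast]
    rw [kernel, if_pos h0, h1, invFourier_shell hχ, Pi.sub_apply, lowKernel_succ, lowKernel_succ,
      dil, dil, smul_smul, pow_succ]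
    rw [mul_comm (2 : ℝ) (2 ^ n)]
    ring_nf

/-! ### Integral inequalities: Hölder, Young, Fubini -/

section Norm

variable {E F G : Type*} [NormedAddCommGroup E] [NormedAddCommGroup F] [NormedAddCommGroup G]

theorem aestronglyMeasurable_comp_sub {f : E3 → F} (hf : AEStronglyMeasurable f) :
    AEStronglyMeasurable (fun p : E3 × E3 => f (p.1 - p.2)) (volume.prod volume) :=
  hf.comp_quasiMeasurePreserving (quasiMeasurePreserving_sub_of_right_invariant volume volume)

theorem _root_.MeasureTheory.MemLp.comp_sub_const {f : E3 → F} {p : ℝ≥0∞} (hf : MemLp f p)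
    (y : E3) : MemLp (fun x => f (x - y)) p :=
  hf.comp_measurePreserving (measurePreserving_sub_right volume y)

theorem _root_.MeasureTheory.MemLp.comp_add_const {f : E3 → F} {p : ℝ≥0∞} (hf : MemLp f p)
    (y : E3) : MemLp (fun x => f (x + y)) p :=
  hf.comp_measurePreserving (measurePreserving_add_right volume y)

theorem lpNorm_comp_sub_const {f : E3 → F} {p : ℝ≥0∞} (hf : AEStronglyMeasurable f) (y : E3) :
    lpNorm (fun x => f (x - y)) p volume = lpNorm f p volume := by
  have hm := measurePreserving_sub_right (volume : Measure E3) y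
  have h2 : AEStronglyMeasurable (fun x => f (x - y)) := hf.comp_measurePreserving hm
  rw [← toReal_eLpNorm hf, ← toReal_eLpNorm h2]
  exact congrArg ENNReal.toReal (eLpNorm_comp_measurePreserving hf hm)

theorem lpNorm_comp_add_const {f : E3 → F} {p : ℝ≥0∞} (hf : AEStronglyMeasurable f) (y : E3) :
    lpNorm (fun x => f (x + y)) p volume = lpNorm f p volume := by
  simpa using lpNorm_comp_sub_const (p := p) hf (-y)

theorem integrable_norm_mul_norm_of_memLp_two {α : Type*} [MeasurableSpace α] {μ : Measure α}
    {f : α → E} {g : α → F} (hf : MemLp f 2 μ)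
    (hg : MemLp g 2 μ) : Integrable (fun x => ‖f x‖ * ‖g x‖) μ :=
  hf.norm.integrable_mul hg.norm

theorem memLp_three_of_memLp_two_of_bounded {f : E3 → F} (hf : MemLp f 2) {M : ℝ}
    (hM : ∀ x, ‖f x‖ ≤ M) : MemLp f 3 := by
  have h2 : Integrable fun x => ‖f x‖ ^ 2 := hf.integrable_norm_pow (by norm_num)
  have h3 : Integrable fun x => ‖f x‖ ^ 3 := by
    refine (h2.const_mul M).mono' (hf.1.norm.pow 3) (Eventually.of_forall fun x => ?_)
    rw [Real.norm_of_nonneg (by positivity), pow_succ, mul_comm]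
    gcongr
    exact hM x
  have := (integrable_norm_rpow_iff hf.1 (p := 3) (by norm_num) (by norm_num)).1
  refine this ?_
  simpa using h3

theorem lintegral_mul_mul_le {f : E3 → E} {g : E3 → F} {h : E3 → G} (hf : MemLp f 3)
    (hg : MemLp g 3) (hh : MemLp h 3) :
    ∫⁻ x, ‖f x‖ₑ * ‖g x‖ₑ * ‖h x‖ₑ ≤
      ENNReal.ofReal (lpNorm f 3 volume * lpNorm g 3 volume * lpNorm h 3 volume) := by
  have key := ENNReal.lintegral_prod_norm_pow_le (μ := (volume : Measure E3))
    (Finset.univ : Finset (Fin 3))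
    (f := fun i x => ![‖f x‖ₑ ^ (3 : ℝ), ‖g x‖ₑ ^ (3 : ℝ), ‖h x‖ₑ ^ (3 : ℝ)] i)
    (p := fun _ => 1 / 3)
    (by
      intro i _
      fin_cases i
      · exact hf.1.enorm.pow_const _
      · exact hg.1.enorm.pow_const _
      · exact hh.1.enorm.pow_const _) (by norm_num) (by norm_num)
  have e : ∀ t : ℝ≥0∞, (t ^ (3 : ℝ)) ^ (1 / 3 : ℝ) = t := fun t => by
    rw [← ENNReal.rpow_mul]; norm_num
  have n : ∀ {H : Type _} [NormedAddCommGroup H] (φ : E3 → H),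
      (∫⁻ x, ‖φ x‖ₑ ^ (3 : ℝ)) ^ (1 / 3 : ℝ) = eLpNorm φ 3 := fun φ => by
    rw [eLpNorm_eq_lintegral_rpow_enorm_toReal (by norm_num) (by norm_num)]
    simp
  simp only [Fin.prod_univ_three, Matrix.cons_val_zero, Matrix.cons_val_one, Matrix.cons_val,
    e] at key
  refine key.trans ?_
  have n1 := n f
  have n2 : (∫⁻ x, ‖g x‖ₑ ^ (3 : ℝ)) ^ (1 / 3 : ℝ) = eLpNorm g 3 := by
    rw [eLpNorm_eq_lintegral_rpow_enorm_toReal (by norm_num) (by norm_num)]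
    simp
  have n3 : (∫⁻ x, ‖h x‖ₑ ^ (3 : ℝ)) ^ (1 / 3 : ℝ) = eLpNorm h 3 := by
    rw [eLpNorm_eq_lintegral_rpow_enorm_toReal (by norm_num) (by norm_num)]
    simp
  rw [n1, n2, n3, ENNReal.ofReal_mul (mul_nonneg lpNorm_nonneg lpNorm_nonneg),
    ENNReal.ofReal_mul lpNorm_nonneg,
    ofReal_lpNorm hf, ofReal_lpNorm hg, ofReal_lpNorm hh]

end Norm

section Lp

variable {E F G : Type*} [NormedAddCommGroup E] [NormedSpace ℝ E] [NormedAddCommGroup F]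
  [NormedSpace ℝ F] [NormedAddCommGroup G] [NormedSpace ℝ G]

/-- Hölder's inequality for the splitting a b = a^{1 - 1/r} (a b^r)^{1/r}; this is Jensen's
inequality for the unnormalized weight a. -/
theorem lintegral_mul_rpow_le {α : Type*} [MeasurableSpace α] {μ : Measure α} {a b : α → ℝ≥0∞}
    (ha : AEMeasurable a μ) (hb : AEMeasurable b μ) {r : ℝ} (hr : 1 ≤ r) :
    (∫⁻ y, a y * b y ∂μ) ^ r ≤ (∫⁻ y, a y ∂μ) ^ (r - 1) * ∫⁻ y, a y * b y ^ r ∂μ := by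
  have hr0 : 0 < r := by linarith
  have hq : 0 ≤ 1 - 1 / r := by
    rw [sub_nonneg, div_le_one hr0]; exact hr
  have h := ENNReal.lintegral_mul_norm_pow_le (μ := μ) ha (ha.mul (hb.pow_const r)) hq
    (by positivity : 0 ≤ 1 / r) (by ring)
  have h1 : ∀ y, a y ^ (1 - 1 / r) * (a * fun y => b y ^ r) y ^ (1 / r) = a y * b y := fun y => by
    rw [Pi.mul_apply, ENNReal.mul_rpow_of_nonneg _ _ (by positivity), ← ENNReal.rpow_mul,
      mul_one_div_cancel hr0.ne', ENNReal.rpow_one, ← mul_assoc,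
      ← ENNReal.rpow_add_of_nonneg _ _ hq (by positivity), sub_add_cancel, ENNReal.rpow_one]
  simp only [h1] at h
  refine (ENNReal.rpow_le_rpow h hr0.le).trans ?_
  rw [ENNReal.mul_rpow_of_nonneg _ _ hr0.le, ← ENNReal.rpow_mul, ← ENNReal.rpow_mul,
    one_div_mul_cancel hr0.ne', ENNReal.rpow_one, sub_mul, one_mul, one_div_mul_cancel hr0.ne']
  exact le_rfl

/-- Jensen's inequality in y followed by Tonelli. It takes the place of Minkowski's integral
inequality, both for Young's inequality and for the L² error of the approximate identity. -/
theorem lintegral_rpow_average_le {a : E3 → ℝ≥0∞} {Φ : E3 × E3 → ℝ≥0∞} {Ψ : E3 → ℝ≥0∞}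
    (ha : AEMeasurable a) (hΦ : AEMeasurable Φ (volume.prod volume)) {r : ℝ} (hr : 1 ≤ r)
    (h : ∀ x, Ψ x ≤ ∫⁻ y, a y * Φ (x, y)) :
    ∫⁻ x, Ψ x ^ r ≤ (∫⁻ y, a y) ^ (r - 1) * ∫⁻ y, a y * ∫⁻ x, Φ (x, y) ^ r := by
  have hr0 : 0 ≤ r := by linarith
  have hΦx : ∀ᵐ x : E3, AEMeasurable (fun y => Φ (x, y)) :=
    hΦ.aestronglyMeasurable.prodMk_left.mono fun _ h => h.aemeasurable
  have hΦy : ∀ᵐ y : E3, AEMeasurable (fun x => Φ (x, y)) :=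
    hΦ.prod_swap.aestronglyMeasurable.prodMk_left.mono fun _ h => h.aemeasurable
  have hm : AEMeasurable (fun p : E3 × E3 => a p.2 * Φ p ^ r) (volume.prod volume) :=
    ha.comp_snd.mul (hΦ.pow_const r)
  calc ∫⁻ x, Ψ x ^ r
      ≤ ∫⁻ x, (∫⁻ y, a y) ^ (r - 1) * ∫⁻ y, a y * Φ (x, y) ^ r := by
        refine lintegral_mono_ae ?_
        filter_upwards [hΦx] with x hx
        exact (ENNReal.rpow_le_rpow (h x) hr0).trans (lintegral_mul_rpow_le ha hx hr)
    _ = (∫⁻ y, a y) ^ (r - 1) * ∫⁻ x, ∫⁻ y, a y * Φ (x, y) ^ r :=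
        lintegral_const_mul'' _ hm.lintegral_prod_right'
    _ = (∫⁻ y, a y) ^ (r - 1) * ∫⁻ y, ∫⁻ x, a y * Φ (x, y) ^ r := by
        rw [lintegral_lintegral_swap hm]
    _ = (∫⁻ y, a y) ^ (r - 1) * ∫⁻ y, a y * ∫⁻ x, Φ (x, y) ^ r := by
        congr 1
        refine lintegral_congr_ae ?_
        filter_upwards [hΦy] with y hy
        exact lintegral_const_mul'' _ (hy.pow_const r)

theorem aestronglyMeasurable_convolution (L : E →L[ℝ] F →L[ℝ] G) {k : E3 → E} {f : E3 → F}
    (hk : AEStronglyMeasurable k) (hf : AEStronglyMeasurable f) :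
    AEStronglyMeasurable (k ⋆[L, volume] f) :=
  (hk.convolution_integrand L hf).integral_prod_right'

theorem lintegral_comp_sub_const (f : E3 → ℝ≥0∞) (y : E3) : ∫⁻ x, f (x - y) = ∫⁻ x, f x :=
  lintegral_sub_right_eq_self f y

theorem eLpNorm_convolution_le (L : E →L[ℝ] F →L[ℝ] G) (hL : ∀ a b, ‖L a b‖ ≤ ‖a‖ * ‖b‖)
    {k : E3 → E} {f : E3 → F} (hk : AEStronglyMeasurable k) (hf : AEStronglyMeasurable f)
    {p : ℝ≥0∞} (hp : 1 ≤ p) (hp' : p ≠ ⊤) :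
    eLpNorm (k ⋆[L, volume] f) p ≤ (∫⁻ y, ‖k y‖ₑ) * eLpNorm f p := by
  have hp0 : p ≠ 0 := (zero_lt_one.trans_le hp).ne'
  have hr : 1 ≤ p.toReal := by
    rw [← ENNReal.toReal_one]; exact ENNReal.toReal_mono hp' hp
  have hr0 : 0 < p.toReal := by linarith
  have h := lintegral_rpow_average_le (a := fun y => ‖k y‖ₑ)
    (Φ := fun p => ‖f (p.1 - p.2)‖ₑ) (Ψ := fun x => ‖(k ⋆[L, volume] f) x‖ₑ)
    hk.enorm (aestronglyMeasurable_comp_sub hf).enorm hr fun x => by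
      refine (enorm_integral_le_lintegral_enorm _).trans (lintegral_mono fun y => ?_)
      rw [← ofReal_norm, ← ofReal_norm, ← ofReal_norm, ← ENNReal.ofReal_mul (norm_nonneg _)]
      exact ENNReal.ofReal_le_ofReal (hL _ _)
  have h1 : ∀ y, ∫⁻ x, ‖f (x - y)‖ₑ ^ p.toReal = ∫⁻ x, ‖f x‖ₑ ^ p.toReal := fun y =>
    lintegral_comp_sub_const (fun x => ‖f x‖ₑ ^ p.toReal) y
  simp only [h1] at h
  rw [lintegral_mul_const'' _ hk.enorm, ← mul_assoc] at h
  nth_rewrite 2 [← ENNReal.rpow_one (∫⁻ y, ‖k y‖ₑ)] at h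
  rw [← ENNReal.rpow_add_of_nonneg _ _ (by linarith) (by norm_num), sub_add_cancel] at h
  rw [eLpNorm_eq_lintegral_rpow_enorm_toReal hp0 hp',
    eLpNorm_eq_lintegral_rpow_enorm_toReal hp0 hp']
  refine (ENNReal.rpow_le_rpow h (by positivity)).trans ?_
  rw [ENNReal.mul_rpow_of_nonneg _ _ (by positivity), ← ENNReal.rpow_mul,
    mul_one_div_cancel hr0.ne', ENNReal.rpow_one]

theorem memLp_convolution (L : E →L[ℝ] F →L[ℝ] G) (hL : ∀ a b, ‖L a b‖ ≤ ‖a‖ * ‖b‖)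
    {k : E3 → E} {f : E3 → F} (hk : Integrable k) {p : ℝ≥0∞} (hf : MemLp f p)
    (hp : 1 ≤ p) (hp' : p ≠ ⊤) : MemLp (k ⋆[L, volume] f) p :=
  ⟨aestronglyMeasurable_convolution L hk.1 hf.1,
    (eLpNorm_convolution_le L hL hk.1 hf.1 hp hp').trans_lt (ENNReal.mul_lt_top hk.2 hf.2)⟩

theorem lpNorm_convolution_le (L : E →L[ℝ] F →L[ℝ] G) (hL : ∀ a b, ‖L a b‖ ≤ ‖a‖ * ‖b‖)
    {k : E3 → E} {f : E3 → F} (hk : Integrable k) {p : ℝ≥0∞} (hf : MemLp f p)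
    (hp : 1 ≤ p) (hp' : p ≠ ⊤) :
    lpNorm (k ⋆[L, volume] f) p volume ≤ (∫ y, ‖k y‖) * lpNorm f p volume := by
  have h := eLpNorm_convolution_le L hL hk.1 hf.1 hp hp'
  rw [← toReal_eLpNorm hf.1, ← toReal_eLpNorm (aestronglyMeasurable_convolution L hk.1 hf.1),
    integral_norm_eq_lintegral_enorm hk.1, ← ENNReal.toReal_mul]
  exact ENNReal.toReal_mono (ENNReal.mul_lt_top hk.2 hf.2).ne h

theorem norm_lsmul_le (a : ℝ) (b : F) :
    ‖ContinuousLinearMap.lsmul ℝ ℝ a b‖ ≤ ‖a‖ * ‖b‖ := by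
  simp [norm_smul]

theorem convolutionExists_of_memLp_two (L : E →L[ℝ] F →L[ℝ] G)
    (hL : ∀ a b, ‖L a b‖ ≤ ‖a‖ * ‖b‖) {k : E3 → E} {f : E3 → F} (hk : MemLp k 2)
    (hf : MemLp f 2) : ConvolutionExists k f L volume := fun x => by
  have hf' : MemLp (fun y => f (x - y)) 2 :=
    hf.comp_measurePreserving (Measure.measurePreserving_sub_left volume x)
  exact (integrable_norm_mul_norm_of_memLp_two hk hf').mono'
    (L.aestronglyMeasurable_comp₂ hk.1 hf'.1) (Eventually.of_forall fun y => hL _ _)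

theorem exists_norm_convolution_le (L : E →L[ℝ] F →L[ℝ] G)
    (hL : ∀ a b, ‖L a b‖ ≤ ‖a‖ * ‖b‖) {k : E3 → E} {f : E3 → F} (hk : MemLp k 2)
    (hf : MemLp f 2) : ∃ M, ∀ x, ‖(k ⋆[L, volume] f) x‖ ≤ M := by
  refine ⟨(∫ y, ‖k y‖ ^ 2) + ∫ y, ‖f y‖ ^ 2, fun x => ?_⟩
  have hf' : MemLp (fun y => f (x - y)) 2 :=
    hf.comp_measurePreserving (Measure.measurePreserving_sub_left volume x)
  have h1 : ∫ y, ‖f y‖ ^ 2 = ∫ y, ‖f (x - y)‖ ^ 2 :=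
    (integral_sub_left_eq_self (fun y => ‖f y‖ ^ 2) volume x).symm
  have i1 : Integrable fun y => ‖k y‖ ^ 2 := hk.integrable_norm_pow (by norm_num)
  have i2 : Integrable fun y => ‖f (x - y)‖ ^ 2 := hf'.integrable_norm_pow (by norm_num)
  rw [h1, ← integral_add i1 i2]
  refine (norm_integral_le_integral_norm _).trans
    (integral_mono_of_nonneg (Eventually.of_forall fun y => norm_nonneg _) (i1.add i2)
      (Eventually.of_forall fun y => (hL _ _).trans ?_))
  nlinarith [sq_nonneg (‖k y‖ - ‖f (x - y)‖), sq_nonneg ‖k y‖, sq_nonneg ‖f (x - y)‖]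

/-- Fubini for the pairing of a function with a convolution. -/
theorem integral_inner_convolution {κ : E3 → ℝ} (hκ : Integrable κ) {P v : E3 → E3}
    (hP : AEStronglyMeasurable P) (hv : AEStronglyMeasurable v) {B : ℝ}
    (hB : ∀ y, ∫⁻ x, ‖P x‖ₑ * ‖v (x - y)‖ₑ ≤ ENNReal.ofReal B)
    (hex : ConvolutionExists κ v (ContinuousLinearMap.lsmul ℝ ℝ) volume) :
    ∫ x, ⟪P x, (κ ⋆[ContinuousLinearMap.lsmul ℝ ℝ, volume] v) x⟫ =
      ∫ y, κ y * ∫ x, ⟪P x, v (x - y)⟫ := by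
  have hm : AEStronglyMeasurable (fun p : E3 × E3 => ⟪P p.1, κ p.2 • v (p.1 - p.2)⟫)
      (volume.prod volume) :=
    hP.comp_fst.inner (hκ.1.comp_snd.smul (aestronglyMeasurable_comp_sub hv))
  have hi : Integrable (Function.uncurry fun x y : E3 => ⟪P x, κ y • v (x - y)⟫)
      (volume.prod volume) := by
    refine ⟨hm, ?_⟩
    rw [hasFiniteIntegral_iff_enorm]
    calc ∫⁻ p : E3 × E3, ‖⟪P p.1, κ p.2 • v (p.1 - p.2)⟫‖ₑ ∂(volume.prod volume)
        ≤ ∫⁻ p : E3 × E3, ‖κ p.2‖ₑ * (‖P p.1‖ₑ * ‖v (p.1 - p.2)‖ₑ) ∂(volume.prod volume) := by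
          refine lintegral_mono fun p => ?_
          rw [← ofReal_norm, ← ofReal_norm, ← ofReal_norm, ← ofReal_norm,
            ← ENNReal.ofReal_mul (norm_nonneg _), ← ENNReal.ofReal_mul (norm_nonneg _)]
          refine ENNReal.ofReal_le_ofReal ((norm_inner_le_norm _ _).trans (le_of_eq ?_))
          rw [norm_smul]; ring
      _ = ∫⁻ y, ∫⁻ x, ‖κ y‖ₑ * (‖P x‖ₑ * ‖v (x - y)‖ₑ) := by
          rw [lintegral_prod_symm]
          exact hκ.1.enorm.comp_snd.mul
            (hP.enorm.comp_fst.mul (aestronglyMeasurable_comp_sub hv).enorm)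
      _ ≤ ∫⁻ y, ‖κ y‖ₑ * ENNReal.ofReal B := by
          refine lintegral_mono fun y => ?_
          rw [lintegral_const_mul' _ _ enorm_ne_top]
          gcongr
          exact hB y
      _ < ⊤ := by
          rw [lintegral_mul_const'' _ hκ.1.enorm]
          exact ENNReal.mul_lt_top hκ.2 ENNReal.ofReal_lt_top
  calc ∫ x, ⟪P x, (κ ⋆[ContinuousLinearMap.lsmul ℝ ℝ, volume] v) x⟫
      = ∫ x, ∫ y, ⟪P x, κ y • v (x - y)⟫ := by
        refine integral_congr_ae (Eventually.of_forall fun x => ?_)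
        exact (integral_inner (hex x) (P x)).symm
    _ = ∫ y, ∫ x, ⟪P x, κ y • v (x - y)⟫ := integral_integral_swap hi
    _ = ∫ y, κ y * ∫ x, ⟪P x, v (x - y)⟫ := by
        refine integral_congr_ae (Eventually.of_forall fun y => ?_)
        simp only [real_inner_smul_right]
        rw [integral_const_mul]

end Lp

/-! ### Telescoping the cube of the `L³` norm -/

/-- The real-valued `L³` norm. -/
abbrev nrm3 {F : Type*} [NormedAddCommGroup F] (f : E3 → F) : ℝ := lpNorm f 3 volume

theorem nrm3_pow {F : Type*} [NormedAddCommGroup F] {f : E3 → F} (hf : MemLp f 3) :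
    nrm3 f ^ 3 = ∫ x, ‖f x‖ ^ 3 := by
  rw [nrm3, lpNorm_eq_integral_norm_rpow_toReal (by norm_num) (by norm_num) hf.1]
  have h0 : 0 ≤ ∫ x, ‖f x‖ ^ (3 : ℝ) := integral_nonneg fun x => by positivity
  simp only [ENNReal.toReal_ofNat]
  rw [← Real.rpow_natCast, ← Real.rpow_mul h0]
  norm_num

theorem integral_mul_mul_le {E F G : Type*} [NormedAddCommGroup E] [NormedAddCommGroup F]
    [NormedAddCommGroup G] {f : E3 → E} {g : E3 → F} {h : E3 → G} (hf : MemLp f 3)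
    (hg : MemLp g 3) (hh : MemLp h 3) :
    Integrable (fun x => ‖f x‖ * ‖g x‖ * ‖h x‖) ∧
      ∫ x, ‖f x‖ * ‖g x‖ * ‖h x‖ ≤ nrm3 f * nrm3 g * nrm3 h := by
  have hm : AEStronglyMeasurable (fun x => ‖f x‖ * ‖g x‖ * ‖h x‖) :=
    (hf.1.norm.mul hg.1.norm).mul hh.1.norm
  have key := lintegral_mul_mul_le hf hg hh
  have e : ∀ x, ‖f x‖ₑ * ‖g x‖ₑ * ‖h x‖ₑ = ENNReal.ofReal (‖f x‖ * ‖g x‖ * ‖h x‖) := fun x => by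
    rw [ENNReal.ofReal_mul (by positivity), ENNReal.ofReal_mul (by positivity), ofReal_norm,
      ofReal_norm, ofReal_norm]
  simp only [e] at key
  have h0 : ∀ x, 0 ≤ ‖f x‖ * ‖g x‖ * ‖h x‖ := fun x => by positivity
  have hi : Integrable (fun x => ‖f x‖ * ‖g x‖ * ‖h x‖) := by
    refine ⟨hm, ?_⟩
    rw [hasFiniteIntegral_iff_ofReal (Eventually.of_forall h0)]
    exact key.trans_lt ENNReal.ofReal_lt_top
  refine ⟨hi, ?_⟩
  rw [← ofReal_integral_eq_lintegral_ofReal hi (Eventually.of_forall h0)] at key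
  exact (ENNReal.ofReal_le_ofReal_iff (mul_nonneg (mul_nonneg lpNorm_nonneg lpNorm_nonneg)
    lpNorm_nonneg)).1 key

theorem norm_norm_smul_sub_le (a b : E3) :
    ‖‖a‖ • a - ‖b‖ • b‖ ≤ (‖a‖ + ‖b‖) * ‖a - b‖ := by
  have h : ‖a‖ • a - ‖b‖ • b = ‖a‖ • (a - b) + (‖a‖ - ‖b‖) • b := by module
  rw [h]
  refine (norm_add_le _ _).trans ?_
  rw [norm_smul, norm_smul, norm_norm, Real.norm_eq_abs, add_mul]
  have := abs_norm_sub_norm_le a b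
  nlinarith [norm_nonneg b]

/-- Put A = |a|, B = |b|, N = |a + b|. Eliminating ⟪a, b⟫ turns N³ - A³ - 3A⟪a, b⟫ into (N - A)²(N +
A/2) + (3/2) A B², and |N - A| ≤ B, N ≤ A + B bound this by 3AB² + B³. -/
theorem norm_add_pow_three_le (a b : E3) :
    ‖a + b‖ ^ 3 ≤ ‖a‖ ^ 3 + 3 * ⟪‖a‖ • a, b⟫ + 3 * (‖a‖ * ‖b‖ * ‖b‖) + ‖b‖ ^ 3 := by
  have h1 : ‖a + b‖ ^ 2 = ‖a‖ ^ 2 + 2 * ⟪a, b⟫ + ‖b‖ ^ 2 := norm_add_sq_real a b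
  have h2 : ‖a + b‖ ≤ ‖a‖ + ‖b‖ := norm_add_le a b
  have h3 : |‖a + b‖ - ‖a‖| ≤ ‖b‖ := by
    simpa using abs_norm_sub_norm_le (a + b) a
  rw [real_inner_smul_left]
  set A := ‖a‖
  set B := ‖b‖
  set N := ‖a + b‖
  set I := ⟪a, b⟫
  have hA : 0 ≤ A := norm_nonneg _
  have hB : 0 ≤ B := norm_nonneg _
  have hN : 0 ≤ N := norm_nonneg _
  have h4 : (N - A) ^ 2 ≤ B ^ 2 := sq_le_sq' (by linarith [abs_le.1 h3]) (by linarith [abs_le.1 h3])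
  have hI : I = (N ^ 2 - A ^ 2 - B ^ 2) / 2 := by linarith
  have h5 : (N - A) ^ 2 * (N + A / 2) ≤ B ^ 2 * (A + B + A / 2) :=
    mul_le_mul h4 (by linarith) (by positivity) (by positivity)
  rw [hI]
  nlinarith

theorem nrm3_add_pow_three_le {g f : E3 → E3} (hg : MemLp g 3) (hf : MemLp f 3) :
    nrm3 (g + f) ^ 3 ≤ nrm3 g ^ 3 + 3 * (∫ x, ⟪‖g x‖ • g x, f x⟫) + 3 * (nrm3 g * nrm3 f ^ 2) +
      nrm3 f ^ 3 := by
  obtain ⟨i1, h1⟩ := integral_mul_mul_le hg hf hf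
  obtain ⟨i2, -⟩ := integral_mul_mul_le hg hg hf
  have i3 : Integrable fun x => ⟪‖g x‖ • g x, f x⟫ := by
    refine i2.mono' ((hg.1.norm.smul hg.1).inner hf.1) (Eventually.of_forall fun x => ?_)
    refine (norm_inner_le_norm _ _).trans (le_of_eq ?_)
    rw [norm_smul, norm_norm]
  have i4 : Integrable fun x => ‖g x‖ ^ 3 := hg.integrable_norm_pow (by norm_num)
  have i5 : Integrable fun x => ‖f x‖ ^ 3 := hf.integrable_norm_pow (by norm_num)
  have i6 : Integrable fun x => ‖(g + f) x‖ ^ 3 := (hg.add hf).integrable_norm_pow (by norm_num)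
  rw [nrm3_pow (hg.add hf), nrm3_pow hg, nrm3_pow hf]
  have h2 : ∫ x, ‖(g + f) x‖ ^ 3 ≤ ∫ x, (‖g x‖ ^ 3 + 3 * ⟪‖g x‖ • g x, f x⟫ +
      3 * (‖g x‖ * ‖f x‖ * ‖f x‖) + ‖f x‖ ^ 3) :=
    integral_mono i6 (((i4.add (i3.const_mul 3)).add (i1.const_mul 3)).add i5)
      fun x => norm_add_pow_three_le _ _
  have j1 : Integrable fun x => ‖g x‖ ^ 3 + 3 * ⟪‖g x‖ • g x, f x⟫ := i4.add (i3.const_mul 3)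
  have j2 : Integrable fun x => ‖g x‖ ^ 3 + 3 * ⟪‖g x‖ • g x, f x⟫ +
      3 * (‖g x‖ * ‖f x‖ * ‖f x‖) := j1.add (i1.const_mul 3)
  rw [integral_add j2 i5, integral_add j1 (i1.const_mul 3), integral_add i4 (i3.const_mul 3),
    integral_const_mul, integral_const_mul] at h2
  nlinarith

/-- The pairing of `|g| g` with a convolution against a kernel of mean zero gains a modulus of
continuity of `g`. -/
theorem abs_integral_inner_convolution_le {κ : E3 → ℝ} (hκ : Integrable κ) (hκ2 : MemLp κ 2)
    (hκ0 : ∫ y, κ y = 0) (hκ1 : Integrable fun y => ‖y‖ * |κ y|) {g v : E3 → E3}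
    (hg : MemLp g 3) (hv : MemLp v 3) (hv2 : MemLp v 2) {A : ℝ} (hA : 0 ≤ A)
    (hgA : ∀ y, nrm3 (fun x => g (x + y) - g x) ≤ A * ‖y‖) :
    |∫ x, ⟪‖g x‖ • g x, (κ ⋆[ContinuousLinearMap.lsmul ℝ ℝ, volume] v) x⟫| ≤
      2 * nrm3 g * nrm3 v * A * ∫ y, ‖y‖ * |κ y| := by
  have hn : ∀ {f : E3 → E3}, 0 ≤ nrm3 f := lpNorm_nonneg
  have hR : 0 ≤ 2 * nrm3 g * nrm3 v * A * ∫ y, ‖y‖ * |κ y| := by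
    have : 0 ≤ ∫ y, ‖y‖ * |κ y| := integral_nonneg fun y => by positivity
    have h1 := hn (f := g)
    have h2 := hn (f := v)
    positivity
  have hPm : AEStronglyMeasurable fun x => ‖g x‖ • g x := hg.1.norm.smul hg.1
  have hB : ∀ y, ∫⁻ x, ‖‖g x‖ • g x‖ₑ * ‖v (x - y)‖ₑ ≤
      ENNReal.ofReal (nrm3 g * nrm3 g * nrm3 v) := fun y => by
    have := lintegral_mul_mul_le hg hg (hv.comp_sub_const y)
    rw [lpNorm_comp_sub_const hv.1] at this
    simpa only [enorm_smul, enorm_norm] using this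
  rw [integral_inner_convolution hκ hPm hv.1 hB
    (convolutionExists_of_memLp_two _ norm_lsmul_le hκ2 hv2)]
  set Φ : E3 → ℝ := fun y => ∫ x, ⟪‖g x‖ • g x, v (x - y)⟫ with hΦ
  by_cases hi : Integrable fun y => κ y * Φ y
  swap
  -- Without integrability the Bochner integral is 0 by convention.
  · rw [integral_undef hi, abs_zero]; exact hR
  have i2 : ∀ y, Integrable fun x => ⟪‖g (x + y)‖ • g (x + y), v x⟫ := fun y => by
    refine (integral_mul_mul_le (hg.comp_add_const y) (hg.comp_add_const y) hv).1.mono'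
      (((hg.comp_add_const y).1.norm.smul (hg.comp_add_const y).1).inner hv.1)
      (Eventually.of_forall fun x => ?_)
    refine (norm_inner_le_norm _ _).trans (le_of_eq ?_)
    rw [norm_smul, norm_norm]
  -- The translation is moved from v to g, so that only the regularity of g is used.
  have hΦy : ∀ y, Φ y = ∫ x, ⟪‖g (x + y)‖ • g (x + y), v x⟫ := fun y => by
    simp only [hΦ]
    rw [← integral_add_right_eq_self (fun x => ⟪‖g x‖ • g x, v (x - y)⟫) y]
    simp
  have hdiff : ∀ y, |Φ y - Φ 0| ≤ 2 * nrm3 g * nrm3 v * A * ‖y‖ := fun y => by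
    have hs : MemLp (fun x => ‖g (x + y)‖ + ‖g x‖) 3 := (hg.comp_add_const y).norm.add hg.norm
    have hd : MemLp (fun x => g (x + y) - g x) 3 := (hg.comp_add_const y).sub hg
    obtain ⟨i3, h3⟩ := integral_mul_mul_le hs hd hv
    have hs' : nrm3 (fun x => ‖g (x + y)‖ + ‖g x‖) ≤ 2 * nrm3 g := by
      refine (lpNorm_add_le (hg.comp_add_const y).norm (g := fun x => ‖g x‖) (by norm_num)).trans ?_
      rw [lpNorm_norm (hg.comp_add_const y).1, lpNorm_norm hg.1, lpNorm_comp_add_const hg.1]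
      linarith
    have h0 : Φ 0 = ∫ x, ⟪‖g x‖ • g x, v x⟫ := by simp [hΦ]
    have i0 := i2 0
    simp only [add_zero] at i0
    rw [hΦy, h0, ← integral_sub (i2 y) i0]
    calc |∫ x, (⟪‖g (x + y)‖ • g (x + y), v x⟫ - ⟪‖g x‖ • g x, v x⟫)|
        ≤ ∫ x, ‖‖g (x + y)‖ + ‖g x‖‖ * ‖g (x + y) - g x‖ * ‖v x‖ := by
          refine (abs_integral_le_integral_abs).trans (integral_mono ((i2 y).sub i0).abs i3
            fun x => ?_)
          dsimp only
          rw [← inner_sub_left]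
          refine (abs_real_inner_le_norm _ _).trans ?_
          gcongr
          rw [Real.norm_of_nonneg (by positivity)]
          exact norm_norm_smul_sub_le _ _
      _ ≤ _ := h3
      _ ≤ (2 * nrm3 g) * (A * ‖y‖) * nrm3 v := by
          gcongr
          · exact hn
          · exact lpNorm_nonneg
          · exact mul_nonneg zero_le_two hn
          · exact hgA y
      _ = _ := by ring
  -- The mean-zero condition allows Φ 0 to be subtracted for free.
  have e : ∫ y, κ y * Φ y = ∫ y, κ y * (Φ y - Φ 0) := by
    simp only [mul_sub]
    rw [integral_sub hi (hκ.mul_const _), integral_mul_const, hκ0]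
    ring
  rw [e]
  calc |∫ y, κ y * (Φ y - Φ 0)| ≤ ∫ y, |κ y * (Φ y - Φ 0)| := abs_integral_le_integral_abs
    _ ≤ ∫ y, 2 * nrm3 g * nrm3 v * A * (‖y‖ * |κ y|) := by
        refine integral_mono_of_nonneg (Eventually.of_forall fun y => abs_nonneg _)
          (hκ1.const_mul _) (Eventually.of_forall fun y => ?_)
        dsimp only
        rw [abs_mul]
        calc |κ y| * |Φ y - Φ 0| ≤ |κ y| * (2 * nrm3 g * nrm3 v * A * ‖y‖) := by
              gcongr; exact hdiff y
          _ = _ := by ring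
    _ = _ := integral_const_mul _ _

/-- The discrete inequality which closes the `L³` telescoping argument. -/
theorem sq_le_sum_of_cube_le {b X T : ℕ → ℝ} {m N : ℕ} {A : ℝ} (hA : 0 ≤ A) (hmN : m ≤ N)
    (hb : ∀ n, 0 ≤ b n) (hX : ∀ n, 0 ≤ X n) (hXm : X m = 0) (hTm : T m = 0)
    (hT0 : ∀ n, 0 ≤ T n) (hT : ∀ n, m ≤ n → T (n + 1) = (T n + b n) / 2)
    (h2 : ∀ n, m ≤ n → b n ≤ X (n + 1) + X n)
    (h1 : ∀ n, m ≤ n → X (n + 1) ^ 3 ≤ X n ^ 3 + A * X n * (b (n - 1) + b n + b (n + 1)) * T n +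
      3 * (X n * b n ^ 2) + b n ^ 3) :
    X N ^ 2 ≤ (13 / 2 * A + 5) * ∑ n ∈ Finset.Icc (m - 1) N, b n ^ 2 := by
  set S := ∑ n ∈ Finset.Icc (m - 1) N, b n ^ 2
  have hS0 : 0 ≤ S := Finset.sum_nonneg fun n _ => sq_nonneg _
  -- The recursion is run up to a maximizer of X on [m, N]: every X n there is at most M, so M³ ≤ M
  -- · (sum of squares) and one factor M cancels.
  obtain ⟨N₀, hN₀, hmax⟩ := Finset.exists_max_image (Finset.Icc m N) X ⟨m, by simp [hmN]⟩
  rw [Finset.mem_Icc] at hN₀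
  set M := X N₀
  have hM : ∀ n, m ≤ n → n ≤ N → X n ≤ M := fun n h h' => hmax n (Finset.mem_Icc.2 ⟨h, h'⟩)
  have hM0 : 0 ≤ M := hX _
  have hsum : ∀ n, m ≤ n → n ≤ N → X n ^ 3 ≤ M * ∑ j ∈ Finset.Ico m n,
      (A / 2 * ((b (j - 1) + b j + b (j + 1)) ^ 2 + T j ^ 2) + 5 * b j ^ 2) := by
    intro n hn
    induction n, hn using Nat.le_induction with
    | base => intro _; simp [hXm]
    | succ n hn ih =>
      intro hnN
      rw [Finset.sum_Ico_succ_top hn, mul_add]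
      have hXn := hM n hn (by omega)
      have hXn' := hM (n + 1) (by omega) hnN
      have hbn := h2 n hn
      have hB : 0 ≤ b (n - 1) + b n + b (n + 1) :=
        add_nonneg (add_nonneg (hb _) (hb _)) (hb _)
      have t1 : A * X n * (b (n - 1) + b n + b (n + 1)) * T n ≤
          M * (A / 2 * ((b (n - 1) + b n + b (n + 1)) ^ 2 + T n ^ 2)) := by
        have e1 : (b (n - 1) + b n + b (n + 1)) * T n ≤
            ((b (n - 1) + b n + b (n + 1)) ^ 2 + T n ^ 2) / 2 := by
          nlinarith [sq_nonneg ((b (n - 1) + b n + b (n + 1)) - T n)]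
        calc A * X n * (b (n - 1) + b n + b (n + 1)) * T n
            = A * X n * ((b (n - 1) + b n + b (n + 1)) * T n) := by ring
          _ ≤ A * M * (((b (n - 1) + b n + b (n + 1)) ^ 2 + T n ^ 2) / 2) :=
            mul_le_mul (mul_le_mul_of_nonneg_left hXn hA) e1 (mul_nonneg hB (hT0 n))
              (mul_nonneg hA hM0)
          _ = _ := by ring
      have t2 : X n * b n ^ 2 ≤ M * b n ^ 2 := mul_le_mul_of_nonneg_right hXn (sq_nonneg _)
      -- From b n ≤ X (n + 1) + X n ≤ 2M; together with the term 3 X b² this gives the coefficient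
      -- 5.
      have t3 : b n ^ 3 ≤ 2 * M * b n ^ 2 := by
        rw [pow_succ, mul_comm]
        exact mul_le_mul_of_nonneg_right (by linarith) (sq_nonneg _)
      have := h1 n hn
      have := ih (by omega)
      linarith
  -- The ℓ² bound for the geometric averages. The extra 2 T² makes the induction close, since (T +
  -- b)²/2 ≤ T² + b².
  have hTsum : ∀ n, m ≤ n → ∑ j ∈ Finset.Ico m n, T j ^ 2 + 2 * T n ^ 2 ≤
      ∑ j ∈ Finset.Ico m n, b j ^ 2 := by
    intro n hn
    induction n, hn using Nat.le_induction with
    | base => simp [hTm]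
    | succ n hn ih =>
      rw [Finset.sum_Ico_succ_top hn, Finset.sum_Ico_succ_top hn, hT n hn]
      nlinarith [sq_nonneg (T n - b n)]
  have hb0 : ∑ j ∈ Finset.Ico m N₀, b j ^ 2 ≤ S :=
    Finset.sum_le_sum_of_subset_of_nonneg (fun j hj => by
      rw [Finset.mem_Ico] at hj; rw [Finset.mem_Icc]; omega) fun _ _ _ => sq_nonneg _
  have hb1 : ∑ j ∈ Finset.Ico m N₀, b (j + 1) ^ 2 ≤ S := by
    rw [Finset.sum_Ico_add' (fun j => b j ^ 2) m N₀ 1]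
    exact Finset.sum_le_sum_of_subset_of_nonneg (fun j hj => by
      rw [Finset.mem_Ico] at hj; rw [Finset.mem_Icc]; omega) fun _ _ _ => sq_nonneg _
  -- The bound is 2S rather than S: when m = 0 truncated subtraction counts b 0 twice, so the term j
  -- = m is treated apart.
  have hbm : ∑ j ∈ Finset.Ico m N₀, b (j - 1) ^ 2 ≤ S + S := by
    have hz : ∀ j ∈ Finset.Ico m N₀, b (j - 1) ^ 2 ≤ (if j = m then b (m - 1) ^ 2 else 0) +
        (if j = m then 0 else b (j - 1) ^ 2) := fun j _ => by
      split_ifs with h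
      · rw [h]; linarith
      · linarith
    refine (Finset.sum_le_sum hz).trans ?_
    rw [Finset.sum_add_distrib]
    have p1 : ∑ j ∈ Finset.Ico m N₀, (if j = m then b (m - 1) ^ 2 else 0) ≤ S := by
      rw [Finset.sum_ite_eq']
      split_ifs
      · exact Finset.single_le_sum (f := fun n => b n ^ 2) (fun _ _ => sq_nonneg _)
          (Finset.mem_Icc.2 ⟨le_rfl, by omega⟩)
      · exact hS0
    have p2 : ∑ j ∈ Finset.Ico m N₀, (if j = m then 0 else b (j - 1) ^ 2) ≤ S := by
      rcases hN₀.1.eq_or_lt with h | h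
      · simp [← h, hS0]
      · have hshift := Finset.sum_Ico_add' (fun j => if j = m then 0 else b (j - 1) ^ 2)
          m (N₀ - 1) 1
        rw [Nat.sub_add_cancel (by omega)] at hshift
        rw [Finset.sum_eq_sum_Ico_succ_bot h, if_pos rfl, zero_add, ← hshift]
        refine le_trans (Finset.sum_le_sum fun j hj => ?_) (hb0.trans'
          (Finset.sum_le_sum_of_subset_of_nonneg (s := Finset.Ico m (N₀ - 1))
            (Finset.Ico_subset_Ico_right (by omega)) fun _ _ _ => sq_nonneg _))
        split_ifs <;> simp [sq_nonneg]
    linarith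
  have hfin := hsum N₀ hN₀.1 hN₀.2
  have hbound : ∑ j ∈ Finset.Ico m N₀,
      (A / 2 * ((b (j - 1) + b j + b (j + 1)) ^ 2 + T j ^ 2) + 5 * b j ^ 2) ≤
      (13 / 2 * A + 5) * S := by
    calc _ ≤ ∑ j ∈ Finset.Ico m N₀, (A / 2 * (3 * (b (j - 1) ^ 2 + b j ^ 2 + b (j + 1) ^ 2) +
          T j ^ 2) + 5 * b j ^ 2) := by
          refine Finset.sum_le_sum fun j _ => ?_
          gcongr
          nlinarith [sq_nonneg (b (j - 1) - b j), sq_nonneg (b (j - 1) - b (j + 1)),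
            sq_nonneg (b j - b (j + 1))]
      _ = A / 2 * (3 * (∑ j ∈ Finset.Ico m N₀, b (j - 1) ^ 2 + ∑ j ∈ Finset.Ico m N₀, b j ^ 2 +
          ∑ j ∈ Finset.Ico m N₀, b (j + 1) ^ 2) + ∑ j ∈ Finset.Ico m N₀, T j ^ 2) +
          5 * ∑ j ∈ Finset.Ico m N₀, b j ^ 2 := by
          simp only [Finset.sum_add_distrib, ← Finset.mul_sum]
      -- The count 3 · 4 + 1 = 13 is the source of the constant 13/2.
      _ ≤ A / 2 * (3 * ((S + S) + S + S) + S) + 5 * S := by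
          have := hTsum N₀ hN₀.1
          have : ∑ j ∈ Finset.Ico m N₀, T j ^ 2 ≤ S := by nlinarith [sq_nonneg (T N₀)]
          gcongr
      _ = _ := by ring
  have hMS : M ^ 3 ≤ M * ((13 / 2 * A + 5) * S) :=
    hfin.trans (mul_le_mul_of_nonneg_left hbound hM0)
  have hM2 : M ^ 2 ≤ (13 / 2 * A + 5) * S := by
    rcases hM0.eq_or_lt with h | h
    · rw [← h]; simp only [ne_eq, OfNat.ofNat_ne_zero, not_false_eq_true, zero_pow]; positivity
    · refine le_of_mul_le_mul_left ?_ h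
      calc M * M ^ 2 = M ^ 3 := by ring
        _ ≤ _ := hMS
  calc X N ^ 2 ≤ M ^ 2 := pow_le_pow_left₀ (hX N) (hM N hmN le_rfl) 2
    _ ≤ _ := hM2

/-! ### Algebra of low-pass filters and the embedding of `B⁰_{3,2}` -/

section Conv

variable {F : Type*} [NormedAddCommGroup F] [NormedSpace ℝ F]

/-- Convolution with a scalar kernel. -/
abbrev conv (k : E3 → ℝ) (f : E3 → F) : E3 → F :=
  k ⋆[ContinuousLinearMap.lsmul ℝ ℝ, volume] f

theorem conv_apply (k : E3 → ℝ) (f : E3 → F) (x : E3) : conv k f x = ∫ y, k y • f (x - y) := rfl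

theorem integrable_conv {k : E3 → ℝ} {f : E3 → F} (hk : MemLp k 2) (hf : MemLp f 2)
    (x : E3) : Integrable fun y => k y • f (x - y) :=
  convolutionExists_of_memLp_two _ norm_lsmul_le hk hf x

theorem sub_conv {k l : E3 → ℝ} {f : E3 → F} (hk : MemLp k 2) (hl : MemLp l 2)
    (hf : MemLp f 2) : conv (k - l) f = conv k f - conv l f := by
  ext1 x
  rw [Pi.sub_apply, conv_apply, conv_apply, conv_apply,
    ← integral_sub (integrable_conv hk hf x) (integrable_conv hl hf x)]
  simp only [Pi.sub_apply, sub_smul]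

theorem conv_sub {k : E3 → ℝ} {f g : E3 → F} (hk : MemLp k 2) (hf : MemLp f 2)
    (hg : MemLp g 2) : conv k (f - g) = conv k f - conv k g := by
  ext1 x
  rw [Pi.sub_apply, conv_apply, conv_apply, conv_apply,
    ← integral_sub (integrable_conv hk hf x) (integrable_conv hk hg x)]
  simp only [Pi.sub_apply, smul_sub]

theorem conv_comp_add (k : E3 → ℝ) (f : E3 → F) (y : E3) :
    (fun x => conv k f (x + y)) = conv k fun x => f (x + y) := by
  ext1 x
  rw [conv_apply, conv_apply]
  congr 1; ext1 z
  congr 2; abel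

theorem conv_comp_add_left (k : E3 → ℝ) (f : E3 → F) (y : E3) :
    (fun x => conv k f (x + y)) = conv (fun x => k (x + y)) f := by
  ext1 x
  rw [conv_apply, conv_apply, ← integral_add_right_eq_self (fun z => k z • f (x + y - z)) y]
  congr 1; ext1 z
  congr 2; abel

theorem conv_conv [CompleteSpace F] {k l : E3 → ℝ} {f : E3 → F} (hk : MemLp k 2)
    (hl : MemLp l 2) (hl1 : Integrable l) (hf : MemLp f 2) :
    conv k (conv l f) = conv (conv k l) f := by
  ext1 x
  symm
  refine convolution_assoc (𝕜 := ℝ) _ _ _ _ (fun a b z => ?_) hk.1 hl.1 hf.1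
    (Eventually.of_forall (integrable_conv hk hl)) (Eventually.of_forall ?_) ?_
  · exact mul_smul a b z
  · exact convolutionExists_of_memLp_two _ (by simp) hl.norm hf.norm
  · exact convolutionExists_of_memLp_two _ (by simp) hk.norm
      (memLp_convolution _ (by simp) hl1.norm hf.norm one_le_two (by norm_num)) x

theorem conv_comm (k l : E3 → ℝ) : conv k l = conv l k := by
  ext1 x
  rw [conv_apply, conv_apply, ← integral_sub_left_eq_self _ volume x]
  simp [mul_comm]

end Conv

section LowPass

variable {χ : E3 → ℝ} (hχ : IsCutoff χ)

include hχ

theorem integrable_lowKernel (n : ℕ) : Integrable (lowKernel χ n) := by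
  rcases n with _ | n
  · exact integrable_zero _ _ _
  · exact integrable_dil hχ (by positivity)

theorem memLp_dil {t : ℝ} (ht : 0 < t) (p : ℝ≥0∞) : MemLp (dil χ t) p := by
  obtain ⟨k, hk⟩ := exists_schwartz_dil hχ ht
  rw [← hk]; exact k.memLp p

theorem memLp_lowKernel (n : ℕ) (p : ℝ≥0∞) : MemLp (lowKernel χ n) p := by
  rcases n with _ | n
  · exact MemLp.zero
  · exact memLp_dil hχ (by positivity) p

theorem lowKernel_conv {m n : ℕ} (h : m < n) :
    conv (lowKernel χ m) (lowKernel χ n) = lowKernel χ m := by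
  rcases m with _ | m
  · exact zero_convolution
  · obtain ⟨n, rfl⟩ : ∃ k, n = k + 1 := ⟨n - 1, by omega⟩
    refine dil_convolution_dil hχ (by positivity) ?_
    rw [← pow_succ']
    exact pow_le_pow_right₀ one_le_two (by omega)

variable {F : Type*} [NormedAddCommGroup F] [NormedSpace ℝ F]

omit hχ in
/-- `lowPass χ w (Q + 2)` is `S_Q w`. -/
abbrev lowPass (χ : E3 → ℝ) (w : E3 → F) (n : ℕ) : E3 → F := conv (lowKernel χ n) w

omit hχ in
theorem lowPass_zero (w : E3 → F) : lowPass χ w 0 = 0 := zero_convolution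

/-- `shellPart χ w n` is `Δ_{n-1} w`. -/
abbrev shellPart (χ : E3 → ℝ) (w : E3 → F) (n : ℕ) : E3 → F := block χ ((n : ℤ) - 1) w

theorem shellPart_eq {w : E3 → F} (hw : MemLp w 2) (n : ℕ) :
    shellPart χ w n = lowPass χ w (n + 1) - lowPass χ w n := by
  rw [shellPart, block, kernel_eq_lowKernel_sub hχ]
  exact sub_conv (memLp_lowKernel hχ _ 2) (memLp_lowKernel hχ _ 2) hw

theorem memLp_lowPass {w : E3 → F} (hw : MemLp w 2) (n : ℕ) : MemLp (lowPass χ w n) 2 :=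
  memLp_convolution _ norm_lsmul_le (integrable_lowKernel hχ n) hw one_le_two (by norm_num)

theorem memLp_three_lowPass {w : E3 → F} (hw : MemLp w 2) (n : ℕ) :
    MemLp (lowPass χ w n) 3 := by
  obtain ⟨M, hM⟩ := exists_norm_convolution_le (ContinuousLinearMap.lsmul ℝ ℝ) norm_lsmul_le
    (memLp_lowKernel hχ n 2) hw
  exact memLp_three_of_memLp_two_of_bounded (memLp_lowPass hχ hw n) hM

theorem memLp_shellPart {w : E3 → F} (hw : MemLp w 2) (n : ℕ) : MemLp (shellPart χ w n) 2 := by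
  rw [shellPart_eq hχ hw]
  exact (memLp_lowPass hχ hw _).sub (memLp_lowPass hχ hw _)

theorem memLp_three_shellPart {w : E3 → F} (hw : MemLp w 2) (n : ℕ) :
    MemLp (shellPart χ w n) 3 := by
  rw [shellPart_eq hχ hw]
  exact (memLp_three_lowPass hχ hw _).sub (memLp_three_lowPass hχ hw _)

theorem conv_lowPass_of_lt [CompleteSpace F] {w : E3 → F} (hw : MemLp w 2) {m n : ℕ} (h : m < n) :
    conv (lowKernel χ m) (lowPass χ w n) = lowPass χ w m := by
  rw [lowPass, conv_conv (memLp_lowKernel hχ _ 2) (memLp_lowKernel hχ _ 2)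
    (integrable_lowKernel hχ _) hw, lowKernel_conv hχ h]

theorem conv_lowPass_of_gt [CompleteSpace F] {w : E3 → F} (hw : MemLp w 2) {m n : ℕ} (h : m < n) :
    conv (lowKernel χ n) (lowPass χ w m) = lowPass χ w m := by
  rw [lowPass, conv_conv (memLp_lowKernel hχ _ 2) (memLp_lowKernel hχ _ 2)
    (integrable_lowKernel hχ _) hw, conv_comm, lowKernel_conv hχ h]

/-- The multiplier of the filter is 1 on the frequency support of the block, so the block inherits
the regularity of a fixed kernel at its own scale. -/
theorem conv_shellPart [CompleteSpace F] {w : E3 → F} (hw : MemLp w 2) (n : ℕ) :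
    conv (lowKernel χ (n + 2)) (shellPart χ w n) = shellPart χ w n := by
  rw [shellPart_eq hχ hw, conv_sub (memLp_lowKernel hχ _ 2) (memLp_lowPass hχ hw _)
    (memLp_lowPass hχ hw _), conv_lowPass_of_gt hχ hw (by omega),
    conv_lowPass_of_gt hχ hw (by omega)]

/-- On the frequency support of block n the filter n + 2 acts as 1 and the filter n - 1 as 0. The
block thus becomes a mean-zero kernel (as soon as n ≥ 1) applied to three neighbouring blocks, the
form suited to `abs_integral_inner_convolution_le`. -/
theorem shellPart_eq_conv [CompleteSpace F] {w : E3 → F} (hw : MemLp w 2) {n : ℕ} (hn : 1 ≤ n) :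
    shellPart χ w n = conv (lowKernel χ (n + 1) - lowKernel χ n)
      (lowPass χ w (n + 2) - lowPass χ w (n - 1)) := by
  have h : ∀ j, MemLp (lowKernel χ j) 2 := fun j => memLp_lowKernel hχ j 2
  have h' : ∀ j, MemLp (lowPass χ w j) 2 := fun j => memLp_lowPass hχ hw j
  rw [sub_conv (h _) (h _) ((h' _).sub (h' _)), conv_sub (h _) (h' _) (h' _),
    conv_sub (h _) (h' _) (h' _), conv_lowPass_of_lt hχ hw (m := n + 1) (n := n + 2) (by omega),
    conv_lowPass_of_lt hχ hw (m := n) (n := n + 2) (by omega),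
    conv_lowPass_of_gt hχ hw (m := n - 1) (n := n + 1) (by omega),
    conv_lowPass_of_gt hχ hw (m := n - 1) (n := n) (by omega), shellPart_eq hχ hw]
  abel

theorem lowPass_sub {w w' : E3 → F} (hw : MemLp w 2) (hw' : MemLp w' 2) (n : ℕ) :
    lowPass χ (w - w') n = lowPass χ w n - lowPass χ w' n :=
  conv_sub (memLp_lowKernel hχ _ 2) hw hw'

theorem shellPart_translate_sub {w : E3 → F} (hw : MemLp w 2) (n : ℕ) (y : E3) :
    shellPart χ (fun x => w (x + y) - w x) n =
      fun x => shellPart χ w n (x + y) - shellPart χ w n x := by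
  have h1 : MemLp (fun x => w (x + y)) 2 := hw.comp_add_const y
  have h2 : (fun x => w (x + y) - w x) = (fun x => w (x + y)) - w := rfl
  rw [h2, shellPart_eq hχ (h1.sub hw), lowPass_sub hχ h1 hw, lowPass_sub hχ h1 hw, lowPass,
    ← conv_comp_add, lowPass, lowPass, ← conv_comp_add, shellPart_eq hχ hw]
  ext1 x
  simp only [Pi.sub_apply]
  abel

theorem lowPass_translate_sub {w : E3 → F} (hw : MemLp w 2) (n : ℕ) (y : E3) :
    lowPass χ (fun x => w (x + y) - w x) n =
      fun x => lowPass χ w n (x + y) - lowPass χ w n x := by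
  have h1 : MemLp (fun x => w (x + y)) 2 := hw.comp_add_const y
  have h2 : (fun x => w (x + y) - w x) = (fun x => w (x + y)) - w := rfl
  rw [h2, lowPass_sub hχ h1 hw, lowPass, ← conv_comp_add]
  rfl

/-- Bernstein's inequality in finite-difference form: the increment falls on the reproducing kernel
at scale 2^{n+1}, whose L¹ modulus of continuity is known. -/
theorem exists_nrm3_shellPart_translate_le [CompleteSpace F] :
    ∃ C : ℝ, 0 < C ∧ ∀ w : E3 → F, MemLp w 2 → ∀ (n : ℕ) (y : E3),
      nrm3 (fun x => shellPart χ w n (x + y) - shellPart χ w n x) ≤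
        C * 2 ^ n * ‖y‖ * nrm3 (shellPart χ w n) := by
  obtain ⟨C, hC, hb⟩ := exists_dil_bounds hχ
  refine ⟨2 * C, by positivity, fun w hw n y => ?_⟩
  have ht : (0 : ℝ) < 2 ^ (n + 1) := by positivity
  have e : (fun x => shellPart χ w n (x + y) - shellPart χ w n x) =
      conv (fun x => dil χ (2 ^ (n + 1)) (x + y) - dil χ (2 ^ (n + 1)) x) (shellPart χ w n) := by
    have h1 := conv_comp_add_left (lowKernel χ (n + 2)) (shellPart χ w n) y
    have h2 := conv_shellPart hχ hw n
    have h3 := sub_conv ((memLp_dil hχ ht 2).comp_add_const y) (memLp_dil hχ ht 2)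
      (memLp_shellPart hχ hw n)
    rw [h2] at h1
    refine Eq.trans ?_ h3.symm
    rw [lowKernel_succ] at h1 h2
    rw [h2, ← h1]
    rfl
  rw [e]
  refine (lpNorm_convolution_le _ norm_lsmul_le (((integrable_dil hχ ht).comp_add_right y).sub
    (integrable_dil hχ ht)) (memLp_three_shellPart hχ hw n) (by norm_num) (by norm_num)).trans ?_
  refine mul_le_mul_of_nonneg_right ?_ lpNorm_nonneg
  refine ((hb _ ht).2.2.2 y).trans (le_of_eq ?_)
  ring

/-- The embedding of `B⁰_{3,2}` into `L³`: an `ℓ²` bound for the `L³` norm of a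
difference of partial sums. -/
theorem exists_nrm3_lowPass_sub_le : ∃ C : ℝ, 0 < C ∧ ∀ w : E3 → E3, MemLp w 2 →
    ∀ m N : ℕ, m ≤ N → nrm3 (lowPass χ w N - lowPass χ w m) ^ 2 ≤
      C * ∑ n ∈ Finset.Icc (m - 1) N, nrm3 (shellPart χ w n) ^ 2 := by
  obtain ⟨C, hC, hb⟩ := exists_dil_bounds hχ
  obtain ⟨D, hD, htr⟩ := exists_nrm3_shellPart_translate_le hχ (F := E3)
  refine ⟨13 / 2 * (18 * C * D) + 5, by positivity, fun w hw m N hmN => ?_⟩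
  have s3 : ∀ n, MemLp (lowPass χ w n) 3 := memLp_three_lowPass hχ hw
  have f3 : ∀ n, MemLp (shellPart χ w n) 3 := memLp_three_shellPart hχ hw
  set b : ℕ → ℝ := fun n => nrm3 (shellPart χ w n) with hbdef
  have hb0 : ∀ n, 0 ≤ b n := fun n => lpNorm_nonneg
  set g : ℕ → E3 → E3 := fun n => lowPass χ w n - lowPass χ w m with hg
  have g3 : ∀ n, MemLp (g n) 3 := fun n => (s3 n).sub (s3 m)
  have hstep : ∀ n, g (n + 1) = g n + shellPart χ w n := fun n => by
    rw [shellPart_eq hχ hw]; simp only [hg]; abel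
  -- Up to the factor D, 2^n T n bounds the L³ Lipschitz constant of g n, summed block by block.
  set T : ℕ → ℝ := fun n => (∑ p ∈ Finset.Ico m n, 2 ^ p * b p) / 2 ^ n with hT
  have hT0 : ∀ n, 0 ≤ T n := fun n =>
    div_nonneg (Finset.sum_nonneg fun p _ => mul_nonneg (by positivity) (hb0 p)) (by positivity)
  refine sq_le_sum_of_cube_le (b := b) (X := fun n => nrm3 (g n)) (T := T) (by positivity) hmN
    hb0 (fun n => lpNorm_nonneg) ?_ ?_ hT0 ?_ ?_ ?_
  · simp [hg]
  · simp [hT]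
  · intro n hn
    simp only [hT]
    rw [Finset.sum_Ico_succ_top hn, pow_succ]
    field_simp
  · intro n hn
    have : shellPart χ w n = g (n + 1) - g n := by rw [hstep]; abel
    simp only [hbdef]
    rw [this]
    exact lpNorm_sub_le (g3 _) (by norm_num)
  · intro n hn
    have hcube := nrm3_add_pow_three_le (g3 n) (f3 n)
    rw [← hstep] at hcube
    suffices hcross : 3 * (∫ x, ⟪‖g n x‖ • g n x, shellPart χ w n x⟫) ≤
        18 * C * D * nrm3 (g n) * (b (n - 1) + b n + b (n + 1)) * T n by
      linarith
    -- At n = m the cross term vanishes because g m = 0. Beyond it n ≥ 1, so κ is a difference of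
    -- two kernels of mass 1 and n - 1 is not truncated.
    rcases hn.eq_or_lt with rfl | hlt
    · have : g m = 0 := by simp [hg]
      simp [this, hT]
    · have hn1 : 1 ≤ n := by omega
      have t1 : (0 : ℝ) < 2 ^ n := by positivity
      have t0 : (0 : ℝ) < 2 ^ (n - 1) := by positivity
      obtain ⟨k, rfl⟩ : ∃ k, n = k + 1 := ⟨n - 1, by omega⟩
      simp only [Nat.add_sub_cancel] at t0 ⊢
      have i1 : Integrable fun y => ‖y‖ * |dil χ (2 ^ (k + 1)) y| := by
        simpa using integrable_pow_mul_dil hχ t1 1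
      have i0 : Integrable fun y => ‖y‖ * |dil χ (2 ^ k) y| := by
        simpa using integrable_pow_mul_dil hχ t0 1
      set κ : E3 → ℝ := lowKernel χ (k + 1 + 1) - lowKernel χ (k + 1) with hκ
      have hκi : Integrable κ := (integrable_dil hχ t1).sub (integrable_dil hχ t0)
      have hκle : ∀ y, ‖y‖ * |κ y| ≤ ‖y‖ * |dil χ (2 ^ (k + 1)) y| + ‖y‖ * |dil χ (2 ^ k) y| :=
        fun y => by
          rw [← mul_add]
          exact mul_le_mul_of_nonneg_left (abs_sub _ _) (norm_nonneg _)
      have hκ1 : Integrable fun y => ‖y‖ * |κ y| := by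
        refine (i1.add i0).mono' (continuous_norm.aestronglyMeasurable.mul hκi.1.norm)
          (Eventually.of_forall fun y => ?_)
        rw [Real.norm_of_nonneg (by positivity)]
        exact hκle y
      have hκ0 : ∫ y, κ y = 0 := by
        have := integral_sub (integrable_dil hχ t1) (integrable_dil hχ t0)
        rw [integral_dil hχ t1, integral_dil hχ t0, sub_self] at this
        exact this
      -- Of the 3C, C comes from scale 2^{k+1} and 2C from scale 2^k. With the factor 3 of the cross
      -- term and the factor 2 of the pairing estimate this yields 18 C D.
      have hκb : ∫ y, ‖y‖ * |κ y| ≤ 3 * C / 2 ^ (k + 1) := by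
        refine (integral_mono hκ1 (i1.add i0) hκle).trans ?_
        have e := integral_add i1 i0
        refine (le_of_eq e).trans ?_
        have h1 := (hb _ t1).2.1
        have h0 := (hb _ t0).2.1
        have : C / 2 ^ k = 2 * C / 2 ^ (k + 1) := by rw [pow_succ]; field_simp
        rw [this] at h0
        calc _ ≤ C / 2 ^ (k + 1) + 2 * C / 2 ^ (k + 1) := add_le_add h1 h0
          _ = _ := by ring
      set v : E3 → E3 := lowPass χ w (k + 1 + 2) - lowPass χ w (k + 1 - 1) with hv
      have v3 : MemLp v 3 := (s3 _).sub (s3 _)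
      have v2 : MemLp v 2 := (memLp_lowPass hχ hw _).sub (memLp_lowPass hχ hw _)
      have hvb : nrm3 v ≤ b k + b (k + 1) + b (k + 1 + 1) := by
        have : v = shellPart χ w k + shellPart χ w (k + 1) + shellPart χ w (k + 1 + 1) := by
          rw [shellPart_eq hχ hw, shellPart_eq hχ hw, shellPart_eq hχ hw, hv,
            Nat.add_sub_cancel]
          abel
        rw [this]
        refine (lpNorm_add_le ((f3 _).add (f3 _)) (by norm_num)).trans ?_
        exact add_le_add_left (lpNorm_add_le (f3 _) (by norm_num)) _
      have hgsum : ∀ j, m ≤ j → g j = ∑ p ∈ Finset.Ico m j, shellPart χ w p := by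
        intro j hj
        induction j, hj using Nat.le_induction with
        | base => simp [hg]
        | succ j hj ih => rw [Finset.sum_Ico_succ_top hj, ← ih, hstep]
      have hA : ∀ y, nrm3 (fun x => g (k + 1) (x + y) - g (k + 1) x) ≤
          D * (2 ^ (k + 1) * T (k + 1)) * ‖y‖ := fun y => by
        have e : (fun x => g (k + 1) (x + y) - g (k + 1) x) = ∑ p ∈ Finset.Ico m (k + 1),
            fun x => shellPart χ w p (x + y) - shellPart χ w p x := by
          ext1 x
          rw [hgsum _ hn]
          simp only [Finset.sum_apply, Finset.sum_sub_distrib]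
        rw [e]
        refine (lpNorm_sum_le (fun p _ => ((f3 p).comp_add_const y).sub (f3 p))
          (by norm_num)).trans ?_
        refine (Finset.sum_le_sum fun p _ => htr w hw p y).trans (le_of_eq ?_)
        simp only [hT]
        rw [mul_div_cancel₀ _ t1.ne', Finset.mul_sum, Finset.sum_mul]
        refine Finset.sum_congr rfl fun p _ => ?_
        simp only [hbdef]
        ring
      have hAnn : 0 ≤ D * (2 ^ (k + 1) * T (k + 1)) :=
        mul_nonneg hD.le (mul_nonneg t1.le (hT0 _))
      have hfin := abs_integral_inner_convolution_le hκi
        ((memLp_lowKernel hχ _ 2).sub (memLp_lowKernel hχ _ 2)) hκ0 hκ1 (g3 (k + 1)) v3 v2 hAnn hA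
      have hfe := shellPart_eq_conv hχ hw hn1
      rw [hfe]
      have gn : 0 ≤ nrm3 (g (k + 1)) := lpNorm_nonneg
      have vn : 0 ≤ nrm3 v := lpNorm_nonneg
      have bn : 0 ≤ b k + b (k + 1) + b (k + 1 + 1) := vn.trans hvb
      calc _ ≤ 3 * (2 * nrm3 (g (k + 1)) * nrm3 v * (D * (2 ^ (k + 1) * T (k + 1))) *
            ∫ y, ‖y‖ * |κ y|) :=
            mul_le_mul_of_nonneg_left ((le_abs_self _).trans hfin) (by norm_num)
        _ ≤ 3 * (2 * nrm3 (g (k + 1)) * (b k + b (k + 1) + b (k + 1 + 1)) *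
            (D * (2 ^ (k + 1) * T (k + 1))) * (3 * C / 2 ^ (k + 1))) := by
            gcongr
        _ = _ := by
            field_simp
            ring

end LowPass

/-! ### Smoothness of Schwartz convolutions with `L²` functions -/

section Smooth

variable {F : Type*} [NormedAddCommGroup F] [NormedSpace ℝ F]

theorem exists_one_add_norm_pow_mul_le {V : Type*} [NormedAddCommGroup V] [NormedSpace ℝ V]
    (k : 𝓢(E3, V)) (n : ℕ) : ∃ C : ℝ, ∀ x, (1 + ‖x‖) ^ n * ‖k x‖ ≤ C := by
  have h := SchwartzMap.one_add_le_sup_seminorm_apply (𝕜 := ℝ) (m := (n, 0)) (k := n) (n := 0)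
    le_rfl le_rfl k
  simp only [norm_iteratedFDeriv_zero] at h
  exact ⟨_, h⟩

theorem memLp_two_one_add_norm (x₀ : E3) :
    MemLp (fun t : E3 => ((1 + ‖x₀ - t‖) ^ 4)⁻¹) 2 := by
  have h0 : Integrable fun t : E3 => (1 + ‖t‖) ^ (-(8 : ℝ)) :=
    integrable_one_add_norm (by rw [finrank_euclideanSpace, Fintype.card_fin]; norm_num)
  have hc : Continuous fun t : E3 => ((1 + ‖x₀ - t‖) ^ 4)⁻¹ :=
    Continuous.inv₀ (by fun_prop) fun t => by positivity
  rw [memLp_two_iff_integrable_sq hc.aestronglyMeasurable]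
  have h1 := h0.comp_sub_left x₀
  refine h1.congr (Eventually.of_forall fun t => ?_)
  dsimp only
  rw [Real.rpow_neg (by positivity), inv_pow, ← pow_mul]
  norm_cast

theorem norm_precompL_le {V G : Type*} [NormedAddCommGroup V] [NormedSpace ℝ V]
    [NormedAddCommGroup G] [NormedSpace ℝ G] {L : V →L[ℝ] F →L[ℝ] G}
    (hL : ∀ a b, ‖L a b‖ ≤ ‖a‖ * ‖b‖) (a : E3 →L[ℝ] V) (b : F) :
    ‖L.precompL E3 a b‖ ≤ ‖a‖ * ‖b‖ := by
  refine ContinuousLinearMap.opNorm_le_bound _ (by positivity) fun e => ?_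
  have : L.precompL E3 a b e = L (a e) b := by simp [ContinuousLinearMap.precompL]
  rw [this]
  calc _ ≤ ‖a e‖ * ‖b‖ := hL _ _
    _ ≤ ‖a‖ * ‖e‖ * ‖b‖ := by gcongr; exact a.le_opNorm e
    _ = _ := by ring

/-- Differentiation under the integral. As u is only in L², the kernel's derivative must be
dominated by one L² function for all x near x₀; Schwartz decay provides it. -/
theorem hasFDerivAt_schwartz_convolution {V G : Type*} [NormedAddCommGroup V] [NormedSpace ℝ V]
    [NormedAddCommGroup G] [NormedSpace ℝ G] (L : V →L[ℝ] F →L[ℝ] G)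
    (hL : ∀ a b, ‖L a b‖ ≤ ‖a‖ * ‖b‖) (k : 𝓢(E3, V)) {u : E3 → F} (hu : MemLp u 2) (x₀ : E3) :
    HasFDerivAt (k ⋆[L, volume] u)
      ((SchwartzMap.fderivCLM ℝ E3 V k ⋆[L.precompL E3, volume] u) x₀) x₀ := by
  obtain ⟨C, hC⟩ := exists_one_add_norm_pow_mul_le (SchwartzMap.fderivCLM ℝ E3 V k) 4
  have hC0 : 0 ≤ C := le_trans (by positivity) (hC 0)
  have e1 : (k ⋆[L, volume] u) = fun x => ∫ t, L (k (x - t)) (u t) := by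
    ext1 x; exact convolution_eq_swap _
  have e2 : (SchwartzMap.fderivCLM ℝ E3 V k ⋆[L.precompL E3, volume] u) x₀ =
      ∫ t, L.precompL E3 (SchwartzMap.fderivCLM ℝ E3 V k (x₀ - t)) (u t) := convolution_eq_swap _
  rw [e1, e2]
  have hm : ∀ x, AEStronglyMeasurable (fun t => L (k (x - t)) (u t)) := fun x =>
    L.aestronglyMeasurable_comp₂
      (k.continuous.comp (continuous_const.sub continuous_id)).aestronglyMeasurable hu.1
  have hk2 : MemLp (fun t => k (x₀ - t)) 2 :=
    (k.memLp 2).comp_measurePreserving (Measure.measurePreserving_sub_left volume x₀)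
  refine hasFDerivAt_integral_of_dominated_of_fderiv_le
    -- For |x - x₀| < 1 one has 1 + |x₀ - t| ≤ 2(1 + |x - t|), whence 16 = 2⁴. The power -4 is
    -- square-integrable in dimension 3.
    (bound := fun t => 16 * C * (‖((1 + ‖x₀ - t‖) ^ 4)⁻¹‖ * ‖u t‖))
    (F' := fun x t => L.precompL E3 (SchwartzMap.fderivCLM ℝ E3 V k (x - t)) (u t))
    (Metric.ball_mem_nhds x₀ one_pos) (Eventually.of_forall hm) ?_ ?_ ?_ ?_ ?_
  · refine (integrable_norm_mul_norm_of_memLp_two hk2 hu).mono' (hm x₀)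
      (Eventually.of_forall fun t => hL _ _)
  · exact (L.precompL E3).aestronglyMeasurable_comp₂
      ((SchwartzMap.fderivCLM ℝ E3 V k).continuous.comp
        (continuous_const.sub continuous_id)).aestronglyMeasurable hu.1
  · refine Eventually.of_forall fun t x hx => ?_
    refine (norm_precompL_le hL _ _).trans ?_
    rw [mem_ball_iff_norm] at hx
    have h1 : 1 + ‖x₀ - t‖ ≤ 2 * (1 + ‖x - t‖) := by
      have : x₀ - t = (x - t) - (x - x₀) := by abel
      have h2 : ‖x₀ - t‖ ≤ ‖x - t‖ + ‖x - x₀‖ := by rw [this]; exact norm_sub_le _ _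
      linarith [norm_nonneg (x - t)]
    have h3 : ‖SchwartzMap.fderivCLM ℝ E3 V k (x - t)‖ ≤ 16 * C * ((1 + ‖x₀ - t‖) ^ 4)⁻¹ := by
      rw [← div_eq_mul_inv, le_div_iff₀ (by positivity)]
      calc _ ≤ ‖SchwartzMap.fderivCLM ℝ E3 V k (x - t)‖ * (2 * (1 + ‖x - t‖)) ^ 4 := by gcongr
        _ = 16 * ((1 + ‖x - t‖) ^ 4 * ‖SchwartzMap.fderivCLM ℝ E3 V k (x - t)‖) := by ring
        _ ≤ 16 * C := by gcongr; exact hC _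
    rw [Real.norm_of_nonneg (by positivity)]
    calc _ ≤ (16 * C * ((1 + ‖x₀ - t‖) ^ 4)⁻¹) * ‖u t‖ := by gcongr
      _ = _ := by ring
  · exact (integrable_norm_mul_norm_of_memLp_two (memLp_two_one_add_norm x₀) hu).const_mul _
  · refine Eventually.of_forall fun t x _ => ?_
    have h1 : HasFDerivAt (fun x => k (x - t)) (fderiv ℝ k (x - t)) x :=
      ((k.hasFDerivAt (x - t)).comp x ((hasFDerivAt_id x).sub_const t)).congr_fderiv
        (ContinuousLinearMap.comp_id _)
    have h2 := ((L.flip (u t)).hasFDerivAt (x := k (x - t))).comp x h1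
    refine h2.congr_fderiv ?_
    ext v
    simp [ContinuousLinearMap.precompL]

/-- The derivative is again a Schwartz convolution, with an operator-valued kernel and another
bilinear map; the induction therefore quantifies over these. -/
theorem contDiff_nat_schwartz_convolution {u : E3 → F} (hu : MemLp u 2) (n : ℕ) :
    ∀ {V G : Type} [NormedAddCommGroup V] [NormedSpace ℝ V] [NormedAddCommGroup G]
      [NormedSpace ℝ G] (L : V →L[ℝ] F →L[ℝ] G) (_ : ∀ a b, ‖L a b‖ ≤ ‖a‖ * ‖b‖) (k : 𝓢(E3, V)),
      ContDiff ℝ n (k ⋆[L, volume] u) := by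
  induction n with
  | zero =>
    intro V G _ _ _ _ L hL k
    have hd : Differentiable ℝ (k ⋆[L, volume] u) := fun x =>
      (hasFDerivAt_schwartz_convolution L hL k hu x).differentiableAt
    exact_mod_cast contDiff_zero.2 hd.continuous
  | succ n ih =>
    intro V G _ _ _ _ L hL k
    have hd : ∀ x, HasFDerivAt (k ⋆[L, volume] u) _ x := hasFDerivAt_schwartz_convolution L hL k hu
    push_cast
    rw [contDiff_succ_iff_fderiv]
    refine ⟨fun x => (hd x).differentiableAt, by simp, ?_⟩
    have : fderiv ℝ (k ⋆[L, volume] u) =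
        (SchwartzMap.fderivCLM ℝ E3 V k ⋆[L.precompL E3, volume] u) :=
      funext fun x => (hd x).fderiv
    rw [this]
    exact ih _ (norm_precompL_le hL) _

end Smooth

/-! ### Divergence-free fields -/

section Flow

variable {χ : E3 → ℝ} (hχ : IsCutoff χ)

include hχ

theorem exists_schwartz_lowKernel (n : ℕ) : ∃ k : 𝓢(E3, ℝ), ⇑k = lowKernel χ n := by
  rcases n with _ | n
  · exact ⟨0, rfl⟩
  · exact exists_schwartz_dil hχ (by positivity)

theorem contDiff_lowPass {u : E3 → E3} (hu : MemLp u 2) (n : ℕ) :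
    ContDiff ℝ ∞ (lowPass χ u n) := by
  obtain ⟨k, hk⟩ := exists_schwartz_lowKernel hχ n
  rw [lowPass, ← hk]
  exact contDiff_infty.2 fun m => contDiff_nat_schwartz_convolution hu m _ norm_lsmul_le k

theorem fderiv_lowPass {u : E3 → E3} (hu : MemLp u 2) (n : ℕ) :
    MemLp (fderiv ℝ (lowPass χ u n)) 2 ∧ ∃ M, ∀ x, ‖fderiv ℝ (lowPass χ u n) x‖ ≤ M := by
  obtain ⟨k, hk⟩ := exists_schwartz_lowKernel hχ n
  have hd : fderiv ℝ (lowPass χ u n) = (SchwartzMap.fderivCLM ℝ E3 ℝ k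
      ⋆[(ContinuousLinearMap.lsmul ℝ ℝ).precompL E3, volume] u) := by
    ext1 x
    rw [lowPass, ← hk]
    exact (hasFDerivAt_schwartz_convolution _ norm_lsmul_le k hu x).fderiv
  rw [hd]
  have hL := norm_precompL_le (norm_lsmul_le (F := E3))
  exact ⟨memLp_convolution _ hL (SchwartzMap.fderivCLM ℝ E3 ℝ k).integrable hu one_le_two
    (by norm_num), exists_norm_convolution_le _ hL ((SchwartzMap.fderivCLM ℝ E3 ℝ k).memLp 2) hu⟩

theorem exists_norm_lowPass_le {u : E3 → E3} (hu : MemLp u 2) (n : ℕ) :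
    ∃ M, ∀ x, ‖lowPass χ u n x‖ ≤ M :=
  exists_norm_convolution_le _ norm_lsmul_le (memLp_lowKernel hχ n 2) hu

omit hχ in
/-- A divergence-free `L²` field annihilates gradients of smooth `H¹` functions. -/
theorem IsDivFree.integral_eq_zero {u : E3 → E3} (hu : MemLp u 2) (hdiv : IsDivFree u)
    {ψ : E3 → ℝ} (hψ : ContDiff ℝ ∞ ψ) (hψ2 : MemLp ψ 2) (hdψ : MemLp (fderiv ℝ ψ) 2) :
    ∫ x, fderiv ℝ ψ x (u x) = 0 := by
  let η : ContDiffBump (0 : E3) := ⟨1, 2, one_pos, one_lt_two⟩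
  have hηs : ContDiff ℝ ∞ (η : E3 → ℝ) := η.contDiff
  have hηc : HasCompactSupport (η : E3 → ℝ) := η.hasCompactSupport
  obtain ⟨K, hK⟩ : ∃ K, ∀ x, ‖fderiv ℝ (η : E3 → ℝ) x‖ ≤ K :=
    (hηc.fderiv ℝ).exists_bound_of_continuous (hηs.continuous_fderiv (by simp))
  have hK0 : 0 ≤ K := (norm_nonneg _).trans (hK 0)
  set R : ℕ → ℝ := fun n => ((n : ℝ) + 1)⁻¹ with hR
  have hR0 : ∀ n, 0 < R n := fun n => by positivity
  have hR1 : ∀ n, R n ≤ 1 := fun n =>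
    inv_le_one_of_one_le₀ (by linarith [Nat.cast_nonneg (α := ℝ) n])
  have hRlim : Tendsto R atTop (𝓝 0) := by
    simpa [hR, one_div] using tendsto_one_div_add_atTop_nhds_zero_nat (𝕜 := ℝ)
  set ρ : ℕ → E3 → ℝ := fun n x => η (R n • x) with hρ
  have hρd : ∀ n x, HasFDerivAt (ρ n) (R n • fderiv ℝ (η : E3 → ℝ) (R n • x)) x := fun n x => by
    have h1 : HasFDerivAt (fun x : E3 => R n • x) (R n • ContinuousLinearMap.id ℝ E3) x :=
      (hasFDerivAt_id x).const_smul (R n)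
    have h2 := ((hηs.differentiable (by simp)) (R n • x)).hasFDerivAt.comp x h1
    refine h2.congr_fderiv ?_
    ext v; simp
  have hψd : ∀ x, HasFDerivAt ψ (fderiv ℝ ψ x) x := fun x =>
    (hψ.differentiable (by simp) x).hasFDerivAt
  have hprod : ∀ n x, fderiv ℝ (fun x => ρ n x * ψ x) x (u x) =
      ρ n x * fderiv ℝ ψ x (u x) + ψ x * (R n * fderiv ℝ (η : E3 → ℝ) (R n • x) (u x)) :=
    fun n x => by
      have h := ((hρd n x).mul (hψd x)).fderiv
      rw [show (fun x => ρ n x * ψ x) = ρ n * ψ from rfl, h]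
      simp
  have hzero : ∀ n, ∫ x, fderiv ℝ (fun x => ρ n x * ψ x) x (u x) = 0 := fun n => by
    refine hdiv _ ((hηs.comp (contDiff_const_smul (R n))).mul hψ) ?_
    exact (hηc.comp_smul (hR0 n).ne').mul_right
  -- The truncation η(R n x) ψ(x) is an admissible test function. Its extra gradient term carries
  -- the factor R n → 0 and is dominated by K |ψ| |u|, integrable since both factors are in L².
  have hlim : Tendsto (fun n => ∫ x, fderiv ℝ (fun x => ρ n x * ψ x) x (u x)) atTop
      (𝓝 (∫ x, fderiv ℝ ψ x (u x))) := by
    refine tendsto_integral_of_dominated_convergence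
      (fun x => ‖fderiv ℝ ψ x‖ * ‖u x‖ + K * (‖ψ x‖ * ‖u x‖)) (fun n => ?_) ?_ ?_ ?_
    · have hc : Continuous fun x => fderiv ℝ (fun x => ρ n x * ψ x) x :=
        ((hηs.comp (contDiff_const_smul (R n))).mul hψ).continuous_fderiv (by simp)
      exact (ContinuousLinearMap.id ℝ (E3 →L[ℝ] ℝ)).aestronglyMeasurable_comp₂
        hc.aestronglyMeasurable hu.1
    · exact (integrable_norm_mul_norm_of_memLp_two hdψ hu).add
        ((integrable_norm_mul_norm_of_memLp_two hψ2 hu).const_mul K)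
    · intro n
      refine Eventually.of_forall fun x => ?_
      rw [hprod]
      refine (norm_add_le _ _).trans (add_le_add ?_ ?_)
      · rw [norm_mul, Real.norm_of_nonneg η.nonneg]
        exact (mul_le_of_le_one_left (norm_nonneg _) η.le_one).trans
          (ContinuousLinearMap.le_opNorm _ _)
      · rw [norm_mul, norm_mul, Real.norm_of_nonneg (hR0 n).le]
        have h1 : ‖fderiv ℝ (η : E3 → ℝ) (R n • x) (u x)‖ ≤ K * ‖u x‖ :=
          ContinuousLinearMap.le_of_opNorm_le _ (hK _) _
        calc _ ≤ ‖ψ x‖ * (1 * (K * ‖u x‖)) := by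
              gcongr
              exact hR1 n
          _ = _ := by ring
    · refine Eventually.of_forall fun x => ?_
      simp only [hprod]
      have h1 : Tendsto (fun n => R n • x) atTop (𝓝 0) := by simpa using hRlim.smul_const x
      have h2 : Tendsto (fun n => ρ n x) atTop (𝓝 1) := by
        have := (hηs.continuous.tendsto 0).comp h1
        rwa [η.one_of_mem_closedBall (by simp [η])] at this
      have h3 : Tendsto (fun n => fderiv ℝ (η : E3 → ℝ) (R n • x) (u x)) atTop
          (𝓝 (fderiv ℝ (η : E3 → ℝ) 0 (u x))) := by
        have hc : Continuous fun z => fderiv ℝ (η : E3 → ℝ) z (u x) :=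
          (hηs.continuous_fderiv (by simp)).clm_apply continuous_const
        exact (hc.tendsto 0).comp h1
      simpa using (h2.mul_const (fderiv ℝ ψ x (u x))).add
        ((hRlim.mul h3).const_mul (ψ x))
  simp only [hzero] at hlim
  exact (tendsto_nhds_unique hlim tendsto_const_nhds)

omit hχ in
-- Fubini reduces the claim to translates of u, and a change of variables passes each translation on
-- to ψ.
theorem IsDivFree.integral_conv_eq_zero {u : E3 → E3} (hu : MemLp u 2) (hdiv : IsDivFree u)
    {k : E3 → ℝ} (hk : Integrable k) (hk2 : MemLp k 2)
    {ψ : E3 → ℝ} (hψ : ContDiff ℝ ∞ ψ) (hψ2 : MemLp ψ 2) (hdψ : MemLp (fderiv ℝ ψ) 2) :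
    ∫ x, fderiv ℝ ψ x (conv k u x) = 0 := by
  set P : E3 → E3 := fun x => (InnerProductSpace.toDual ℝ E3).symm (fderiv ℝ ψ x) with hP
  have hPm : AEStronglyMeasurable P :=
    (InnerProductSpace.toDual ℝ E3).symm.continuous.comp_aestronglyMeasurable hdψ.1
  have hPi : ∀ x v, ⟪P x, v⟫ = fderiv ℝ ψ x v := fun x v =>
    InnerProductSpace.toDual_symm_apply
  have hB : ∀ y, ∫⁻ x, ‖P x‖ₑ * ‖u (x - y)‖ₑ ≤
      ENNReal.ofReal ((∫ x, ‖fderiv ℝ ψ x‖ ^ 2) + ∫ x, ‖u x‖ ^ 2) := fun y => by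
    have i1 : Integrable fun x => ‖fderiv ℝ ψ x‖ ^ 2 := hdψ.integrable_norm_pow (by norm_num)
    have i2 : Integrable fun x => ‖u (x - y)‖ ^ 2 :=
      (hu.comp_sub_const y).integrable_norm_pow (by norm_num)
    have i3 : Integrable fun x => ‖fderiv ℝ ψ x‖ ^ 2 + ‖u (x - y)‖ ^ 2 := i1.add i2
    rw [← integral_sub_right_eq_self (fun x => ‖u x‖ ^ 2) y, ← integral_add i1 i2,
      ofReal_integral_eq_lintegral_ofReal i3 (Eventually.of_forall fun x => by positivity)]
    refine lintegral_mono fun x => ?_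
    rw [← ofReal_norm, ← ofReal_norm, ← ENNReal.ofReal_mul (norm_nonneg _)]
    refine ENNReal.ofReal_le_ofReal ?_
    have : ‖P x‖ = ‖fderiv ℝ ψ x‖ := LinearIsometryEquiv.norm_map _ _
    rw [this]
    nlinarith [sq_nonneg (‖fderiv ℝ ψ x‖ - ‖u (x - y)‖), sq_nonneg ‖fderiv ℝ ψ x‖,
      sq_nonneg ‖u (x - y)‖]
  have h := integral_inner_convolution hk hPm hu.1 hB
    (convolutionExists_of_memLp_two _ norm_lsmul_le hk2 hu)
  simp only [hPi] at h
  refine h.trans ?_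
  have hz : ∀ y, ∫ x, fderiv ℝ ψ x (u (x - y)) = 0 := fun y => by
    rw [← integral_add_right_eq_self _ y]
    simp only [add_sub_cancel_right]
    have e : fderiv ℝ (fun x => ψ (x + y)) = fun x => fderiv ℝ ψ (x + y) := by
      ext1 x; exact fderiv_comp_add_right y
    have h1 := hdiv.integral_eq_zero hu (ψ := fun x => ψ (x + y)) (hψ.comp (by fun_prop))
      (hψ2.comp_add_const y) (by rw [e]; exact hdψ.comp_add_const y)
    rwa [e] at h1
  simp [hz]

/-- The resolved self-interaction does not transfer energy. -/
theorem integral_inner_lowPass_eq_zero {u : E3 → E3} (hu : MemLp u 2) (hdiv : IsDivFree u)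
    (n : ℕ) :
    ∫ x, ⟪lowPass χ u n x, fderiv ℝ (lowPass χ u n) x (lowPass χ u n x)⟫ = 0 := by
  set S := lowPass χ u n with hS
  have hSs : ContDiff ℝ ∞ S := contDiff_lowPass hχ hu n
  have hS2 : MemLp S 2 := memLp_lowPass hχ hu n
  obtain ⟨M, hM⟩ := exists_norm_lowPass_le hχ hu n
  obtain ⟨hD2, -⟩ := fderiv_lowPass hχ hu n
  have hM0 : 0 ≤ M := (norm_nonneg _).trans (hM 0)
  -- The integrand is half the derivative of |S|² along S. As S is bounded, |S|² and its gradient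
  -- lie in L² and can be tested against.
  have hd : ∀ x v, fderiv ℝ (fun x => ‖S x‖ ^ 2) x v = 2 * ⟪S x, fderiv ℝ S x v⟫ := fun x v => by
    rw [((hSs.differentiable (by simp) x).hasFDerivAt.norm_sq).fderiv]
    simp
  have hψ : ContDiff ℝ ∞ fun x => ‖S x‖ ^ 2 := hSs.norm_sq ℝ
  have h := hdiv.integral_conv_eq_zero hu (integrable_lowKernel hχ n) (memLp_lowKernel hχ n 2)
    (ψ := fun x => ‖S x‖ ^ 2) hψ ?_ ?_
  · simp only [hd] at h
    rw [integral_const_mul] at h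
    simpa using h
  · refine hS2.of_le_mul (c := M) hψ.continuous.aestronglyMeasurable
      (Eventually.of_forall fun x => ?_)
    rw [Real.norm_of_nonneg (by positivity), sq]
    exact mul_le_mul_of_nonneg_right (hM x) (norm_nonneg _)
  · refine hD2.of_le_mul (c := 2 * M)
      (hψ.continuous_fderiv (by simp)).aestronglyMeasurable (Eventually.of_forall fun x => ?_)
    refine ContinuousLinearMap.opNorm_le_bound _ (by positivity) fun v => ?_
    rw [hd, norm_mul, Real.norm_of_nonneg (zero_le_two (α := ℝ)), mul_assoc, mul_assoc]
    refine mul_le_mul_of_nonneg_left ?_ zero_le_two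
    refine (norm_inner_le_norm _ _).trans ?_
    exact mul_le_mul (hM x) (ContinuousLinearMap.le_opNorm _ _) (norm_nonneg _) hM0

end Flow

/-! ### Convergence of partial sums and `L³` bounds above and below the cut -/

/-- Translations are continuous in `L²`. -/
theorem tendsto_eLpNorm_translate_sub {F : Type*} [NormedAddCommGroup F] {u : E3 → F}
    (hu : MemLp u 2) :
    Tendsto (fun y : E3 => eLpNorm (fun x => u (x - y) - u x) 2) (𝓝 0) (𝓝 0) := by
  let g : E3 → C(E3, E3) := fun y => ⟨fun x => x - y, by fun_prop⟩
  have hgc : Continuous g :=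
    ContinuousMap.continuous_of_continuous_uncurry _ (continuous_snd.sub continuous_fst)
  have hgm : ∀ y, MeasurePreserving (g y) := fun y => measurePreserving_sub_right volume y
  have hc : Continuous fun y => Lp.compMeasurePreserving (g y) (hgm y) (hu.toLp u) :=
    continuous_const.compMeasurePreservingLp hgc hgm (by norm_num)
  have ht := (hc.sub continuous_const).enorm.tendsto (0 : E3)
    (f := fun y => ‖Lp.compMeasurePreserving (g y) (hgm y) (hu.toLp u) - hu.toLp u‖ₑ)
  have he : ∀ y, ‖Lp.compMeasurePreserving (g y) (hgm y) (hu.toLp u) - hu.toLp u‖ₑ =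
      eLpNorm (fun x => u (x - y) - u x) 2 := fun y => by
    rw [Lp.toLp_compMeasurePreserving hu (hgm y), ← MemLp.toLp_sub, Lp.enorm_toLp]
    rfl
  simp only [he] at ht
  simpa using ht

section Approx

variable {χ : E3 → ℝ} (hχ : IsCutoff χ)

include hχ

/-- Mass 1 writes the error as an average of u(x - y) - u(x) against the kernel. The kernel may
change sign, so its L¹ norm appears as a factor. -/
theorem lintegral_lowPass_sub_sq_le {u : E3 → E3} (hu : MemLp u 2) (j : ℕ) :
    ∫⁻ x, ‖lowPass χ u (j + 1) x - u x‖ₑ ^ (2 : ℝ) ≤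
      (∫⁻ y, ‖dil χ (2 ^ j) y‖ₑ) * ∫⁻ y, ‖dil χ (2 ^ j) y‖ₑ *
        eLpNorm (fun x => u (x - y) - u x) 2 ^ (2 : ℝ) := by
  have ht : (0 : ℝ) < 2 ^ j := by positivity
  have hki := integrable_dil hχ ht
  have hm : AEStronglyMeasurable (fun p : E3 × E3 => u (p.1 - p.2) - u p.1)
      (volume.prod volume) := (aestronglyMeasurable_comp_sub hu.1).sub hu.1.comp_fst
  have h := lintegral_rpow_average_le (a := fun y => ‖dil χ (2 ^ j) y‖ₑ)
    (Φ := fun p => ‖u (p.1 - p.2) - u p.1‖ₑ) (Ψ := fun x => ‖lowPass χ u (j + 1) x - u x‖ₑ)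
    hki.1.enorm hm.enorm one_le_two fun x => by
      have e : lowPass χ u (j + 1) x - u x = ∫ y, dil χ (2 ^ j) y • (u (x - y) - u x) := by
        simp only [smul_sub]
        rw [integral_sub (integrable_conv (memLp_dil hχ ht 2) hu x) (hki.smul_const _),
          integral_smul_const, integral_dil hχ ht, one_smul]
        rfl
      rw [e]
      refine (enorm_integral_le_lintegral_enorm _).trans (le_of_eq ?_)
      simp only [enorm_smul]
  have e2 : ∀ y, eLpNorm (fun x => u (x - y) - u x) 2 ^ (2 : ℝ) =
      ∫⁻ x, ‖u (x - y) - u x‖ₑ ^ (2 : ℝ) := fun y => by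
    rw [eLpNorm_eq_lintegral_rpow_enorm_toReal (by norm_num) (by norm_num), ← ENNReal.rpow_mul]
    simp
  simp only [e2]
  have h21 : (2 : ℝ) - 1 = 1 := by norm_num
  rw [h21, ENNReal.rpow_one] at h
  exact h

/-- The partial sums converge in `L²`. -/
theorem tendsto_eLpNorm_lowPass_sub {u : E3 → E3} (hu : MemLp u 2) :
    Tendsto (fun n => eLpNorm (lowPass χ u n - u) 2) atTop (𝓝 0) := by
  obtain ⟨C, hC, hb⟩ := exists_dil_bounds hχ
  set B : ℝ := 4 * lpNorm u 2 volume ^ 2 with hBdef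
  have hB : 0 ≤ B := by positivity
  have hω : ∀ y, eLpNorm (fun x => u (x - y) - u x) 2 ^ (2 : ℝ) ≤ ENNReal.ofReal B := fun y => by
    have h1 : eLpNorm (fun x => u (x - y) - u x) 2 ≤ ENNReal.ofReal (2 * lpNorm u 2 volume) := by
      have hd : MemLp (fun x => u (x - y) - u x) 2 := (hu.comp_sub_const y).sub hu
      rw [← ofReal_lpNorm hd]
      refine ENNReal.ofReal_le_ofReal ((lpNorm_sub_le (hu.comp_sub_const y) (by norm_num)).trans ?_)
      rw [lpNorm_comp_sub_const hu.1]
      linarith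
    refine (ENNReal.rpow_le_rpow h1 zero_le_two).trans (le_of_eq ?_)
    rw [ENNReal.ofReal_rpow_of_nonneg (mul_nonneg zero_le_two lpNorm_nonneg) zero_le_two]
    congr 1
    rw [hBdef, Real.rpow_two]; ring
  -- Continuity near 0 and boundedness away from 0 merge into the majorant ε + A|y|, whose linear
  -- part meets the first moment C/2^j of the kernel.
  have hmod : ∀ ε : ℝ, 0 < ε → ∃ A : ℝ, 0 ≤ A ∧ ∀ y,
      eLpNorm (fun x => u (x - y) - u x) 2 ^ (2 : ℝ) ≤ ENNReal.ofReal (ε + A * ‖y‖) := by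
    intro ε hε
    have ht : Tendsto (fun y : E3 => eLpNorm (fun x => u (x - y) - u x) 2 ^ (2 : ℝ)) (𝓝 0)
        (𝓝 0) := by
      have := (ENNReal.continuous_rpow_const (y := (2 : ℝ))).tendsto (0 : ℝ≥0∞)
      rw [ENNReal.zero_rpow_of_pos two_pos] at this
      exact this.comp (tendsto_eLpNorm_translate_sub hu)
    have hev : ∀ᶠ y : E3 in 𝓝 0,
        eLpNorm (fun x => u (x - y) - u x) 2 ^ (2 : ℝ) ≤ ENNReal.ofReal ε :=
      ht.eventually_le_const (ENNReal.ofReal_pos.2 hε)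
    obtain ⟨δ, hδ, hball⟩ := Metric.eventually_nhds_iff.1 hev
    refine ⟨B / δ, by positivity, fun y => ?_⟩
    by_cases hy : ‖y‖ < δ
    · refine (hball (by simpa using hy)).trans (ENNReal.ofReal_le_ofReal ?_)
      have : 0 ≤ B / δ * ‖y‖ := by positivity
      linarith
    · refine (hω y).trans (ENNReal.ofReal_le_ofReal ?_)
      push Not at hy
      have : B ≤ B / δ * ‖y‖ := by
        rw [div_mul_eq_mul_div, le_div_iff₀ hδ]
        exact mul_le_mul_of_nonneg_left hy hB
      linarith
  have key : ∀ ε A : ℝ, 0 < ε → 0 ≤ A → (∀ y,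
      eLpNorm (fun x => u (x - y) - u x) 2 ^ (2 : ℝ) ≤ ENNReal.ofReal (ε + A * ‖y‖)) →
      ∀ j : ℕ, ∫⁻ x, ‖lowPass χ u (j + 1) x - u x‖ₑ ^ (2 : ℝ) ≤
        ENNReal.ofReal (C * (ε * C + A * (C / 2 ^ j))) := by
    intro ε A hε hA hle j
    have ht : (0 : ℝ) < 2 ^ j := by positivity
    have hki := integrable_dil hχ ht
    have hk1 : Integrable fun y => ‖y‖ * |dil χ (2 ^ j) y| := by
      simpa using integrable_pow_mul_dil hχ ht 1
    refine (lintegral_lowPass_sub_sq_le hχ hu j).trans ?_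
    rw [ENNReal.ofReal_mul hC.le]
    refine mul_le_mul' ?_ ?_
    · rw [← ofReal_integral_norm_eq_lintegral_enorm hki]
      exact ENNReal.ofReal_le_ofReal (hb _ ht).1
    · have hi : Integrable fun y => ε * |dil χ (2 ^ j) y| + A * (‖y‖ * |dil χ (2 ^ j) y|) :=
        (hki.abs.const_mul ε).add (hk1.const_mul A)
      calc _ ≤ ∫⁻ y, ENNReal.ofReal (ε * |dil χ (2 ^ j) y| + A * (‖y‖ * |dil χ (2 ^ j) y|)) := by
            refine lintegral_mono fun y => ?_
            refine (mul_le_mul_right (hle y) _).trans (le_of_eq ?_)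
            rw [← ofReal_norm, ← ENNReal.ofReal_mul (norm_nonneg _), Real.norm_eq_abs]
            congr 1; ring
        _ = ENNReal.ofReal (∫ y, (ε * |dil χ (2 ^ j) y| + A * (‖y‖ * |dil χ (2 ^ j) y|))) :=
            (ofReal_integral_eq_lintegral_ofReal hi
              (Eventually.of_forall fun y => by positivity)).symm
        _ ≤ _ := by
            refine ENNReal.ofReal_le_ofReal ?_
            rw [integral_add (hki.abs.const_mul ε) (hk1.const_mul A), integral_const_mul,
              integral_const_mul]
            have h1 := (hb _ ht).1
            have h2 := (hb _ ht).2.1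
            gcongr
  have hsq : Tendsto (fun n => ∫⁻ x, ‖lowPass χ u n x - u x‖ₑ ^ (2 : ℝ)) atTop (𝓝 0) := by
    rw [← tendsto_add_atTop_iff_nat 1, ENNReal.tendsto_atTop_zero]
    intro η hη
    obtain ⟨η', hη', hη'η⟩ := ENNReal.lt_iff_exists_real_btwn.1 hη
    have hη0 : 0 < η' := ENNReal.ofReal_pos.1 hη'η.1
    obtain ⟨A, hA, hle⟩ := hmod (η' / (2 * C ^ 2)) (by positivity)
    have hlim : Tendsto (fun j : ℕ => C * (A * (C / 2 ^ j))) atTop (𝓝 (C * (A * 0))) := by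
      refine Tendsto.const_mul _ (Tendsto.const_mul _ ?_)
      exact tendsto_const_nhds.div_atTop (tendsto_pow_atTop_atTop_of_one_lt one_lt_two)
    rw [mul_zero, mul_zero] at hlim
    obtain ⟨J, hJ⟩ := eventually_atTop.1 (hlim.eventually_le_const (half_pos hη0))
    refine ⟨J, fun j hj => (key _ A (by positivity) hA hle j).trans (le_trans ?_ hη'η.2.le)⟩
    refine ENNReal.ofReal_le_ofReal ?_
    have h1 := hJ j hj
    have h2 : C * (η' / (2 * C ^ 2) * C) = η' / 2 := by field_simp
    rw [mul_add, h2]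
    linarith
  have e : ∀ n, eLpNorm (lowPass χ u n - u) 2 =
      (∫⁻ x, ‖lowPass χ u n x - u x‖ₑ ^ (2 : ℝ)) ^ (1 / 2 : ℝ) := fun n => by
    rw [eLpNorm_eq_lintegral_rpow_enorm_toReal (by norm_num) (by norm_num)]
    simp
  simp only [e]
  have := (ENNReal.continuous_rpow_const (y := (1 / 2 : ℝ))).tendsto (0 : ℝ≥0∞)
  rw [ENNReal.zero_rpow_of_pos (by norm_num)] at this
  exact this.comp hsq

omit hχ in
-- Fatou's lemma; it yields membership in L³ as well as the bound.
theorem memLp_three_of_tendsto {f : ℕ → E3 → E3} {g : E3 → E3} (hf : ∀ n, MemLp (f n) 3)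
    (hg : AEStronglyMeasurable g) (hfg : ∀ᵐ x, Tendsto (fun n => f n x) atTop (𝓝 (g x)))
    {B : ℝ} (hB : ∀ᶠ n in atTop, nrm3 (f n) ≤ B) : MemLp g 3 ∧ nrm3 g ≤ B := by
  have hB0 : 0 ≤ B := by
    obtain ⟨n, hn⟩ := hB.exists
    exact lpNorm_nonneg.trans hn
  have h := Lp.eLpNorm_lim_le_liminf_eLpNorm (p := 3) (fun n => (hf n).1) g hfg
  have h2 : eLpNorm g 3 ≤ ENNReal.ofReal B := by
    refine h.trans (le_trans (liminf_le_limsup) (limsup_le_of_le (h := ?_)))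
    filter_upwards [hB] with n hn
    rw [← ofReal_lpNorm (hf n)]
    exact ENNReal.ofReal_le_ofReal hn
  have hm : MemLp g 3 := ⟨hg, h2.trans_lt ENNReal.ofReal_lt_top⟩
  refine ⟨hm, ?_⟩
  rw [← ofReal_lpNorm hm] at h2
  exact (ENNReal.ofReal_le_ofReal_iff hB0).1 h2

/-- The `L³` bound for the high-frequency part. -/
theorem exists_nrm3_sub_lowPass_le : ∃ C : ℝ, 0 < C ∧ ∀ u : E3 → E3, MemLp u 2 →
    ∀ (m : ℕ) (B : ℝ), (∀ N, ∑ n ∈ Finset.Icc (m - 1) N, nrm3 (shellPart χ u n) ^ 2 ≤ B) →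
      MemLp (u - lowPass χ u m) 3 ∧ nrm3 (u - lowPass χ u m) ≤ C * √B := by
  obtain ⟨C, hC, hle⟩ := exists_nrm3_lowPass_sub_le hχ
  refine ⟨√C, Real.sqrt_pos.2 hC, fun u hu m B hB => ?_⟩
  -- L² convergence serves only to extract an almost everywhere convergent subsequence, along which
  -- the uniform L³ bounds pass to the limit.
  have hmeas : TendstoInMeasure volume (fun n => lowPass χ u n) atTop u :=
    tendstoInMeasure_of_tendsto_eLpNorm (by norm_num) (fun n => (memLp_lowPass hχ hu n).1) hu.1
      (tendsto_eLpNorm_lowPass_sub hχ hu)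
  obtain ⟨ns, hns, hae⟩ := hmeas.exists_seq_tendsto_ae
  refine memLp_three_of_tendsto (f := fun i => lowPass χ u (ns i) - lowPass χ u m)
    (fun i => (memLp_three_lowPass hχ hu _).sub (memLp_three_lowPass hχ hu _))
    (hu.1.sub (memLp_lowPass hχ hu m).1) ?_ ?_
  · filter_upwards [hae] with x hx
    exact hx.sub_const _
  · filter_upwards [hns.tendsto_atTop.eventually_ge_atTop m] with i hi
    rw [← Real.sqrt_mul hC.le]
    refine Real.le_sqrt_of_sq_le ((hle u hu m (ns i) hi).trans ?_)
    exact mul_le_mul_of_nonneg_left (hB _) hC.le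

/-- `L³` modulus of continuity of the low-frequency part. -/
theorem exists_nrm3_lowPass_translate_le : ∃ C : ℝ, 0 < C ∧ ∀ u : E3 → E3, MemLp u 2 →
    ∀ (N : ℕ) (B : ℝ),
      ∑ n ∈ Finset.Icc 0 N, (2 ^ n) ^ 2 * nrm3 (shellPart χ u n) ^ 2 ≤ B →
      ∀ y, nrm3 (fun x => lowPass χ u N (x + y) - lowPass χ u N x) ≤ C * √B * ‖y‖ := by
  obtain ⟨C, hC, hle⟩ := exists_nrm3_lowPass_sub_le hχ
  obtain ⟨D, hD, htr⟩ := exists_nrm3_shellPart_translate_le hχ (F := E3)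
  refine ⟨√C * D, by positivity, fun u hu N B hB y => ?_⟩
  -- The embedding is applied to the translation difference with m = 0, where the subtracted partial
  -- sum is 0. Each of its blocks gains a factor D 2^n |y|.
  have h := hle (fun x => u (x + y) - u x) ((hu.comp_add_const y).sub hu) 0 N (Nat.zero_le _)
  rw [lowPass_zero, sub_zero, lowPass_translate_sub hχ hu, Nat.zero_sub] at h
  have h2 : ∑ n ∈ Finset.Icc 0 N, nrm3 (shellPart χ (fun x => u (x + y) - u x) n) ^ 2 ≤
      (D * ‖y‖) ^ 2 * B := by
    refine le_trans ?_ (mul_le_mul_of_nonneg_left hB (sq_nonneg _))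
    rw [Finset.mul_sum]
    refine Finset.sum_le_sum fun n _ => ?_
    rw [shellPart_translate_sub hχ hu]
    refine (pow_le_pow_left₀ lpNorm_nonneg (htr u hu n y) 2).trans (le_of_eq ?_)
    ring
  have hB0 : 0 ≤ B := le_trans (Finset.sum_nonneg fun n _ => by positivity) hB
  have h3 := h.trans (mul_le_mul_of_nonneg_left h2 hC.le)
  refine (pow_le_pow_iff_left₀ lpNorm_nonneg (by positivity) two_ne_zero).1
    (h3.trans (le_of_eq ?_))
  rw [mul_pow, mul_pow, mul_pow, mul_pow, Real.sq_sqrt hC.le, Real.sq_sqrt hB0]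
  ring

/-- Directional derivatives are pointwise limits of difference quotients whose L³ norms are at most
A|e|, so Fatou's lemma applies. -/
theorem nrm3_fderiv_lowPass_le {u : E3 → E3} (hu : MemLp u 2) (N : ℕ) {A : ℝ}
    (hA : ∀ y, nrm3 (fun x => lowPass χ u N (x + y) - lowPass χ u N x) ≤ A * ‖y‖) (e : E3) :
    MemLp (fun x => fderiv ℝ (lowPass χ u N) x e) 3 ∧
      nrm3 (fun x => fderiv ℝ (lowPass χ u N) x e) ≤ A * ‖e‖ := by
  set S := lowPass χ u N with hS
  have hSs : ContDiff ℝ ∞ S := contDiff_lowPass hχ hu N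
  have hS3 : MemLp S 3 := memLp_three_lowPass hχ hu N
  set t : ℕ → ℝ := fun n => ((n : ℝ) + 1)⁻¹ with ht
  have ht0 : ∀ n, 0 < t n := fun n => by positivity
  have htlim : Tendsto t atTop (𝓝 0) := by
    simpa [ht, one_div] using tendsto_one_div_add_atTop_nhds_zero_nat (𝕜 := ℝ)
  have hm : ∀ n, MemLp (fun x => S (x + t n • e) - S x) 3 := fun n =>
    (hS3.comp_add_const _).sub hS3
  refine memLp_three_of_tendsto (f := fun n => (t n)⁻¹ • fun x => S (x + t n • e) - S x)
    (fun n => (hm n).const_smul _) ?_ ?_ ?_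
  · exact ((hSs.continuous_fderiv (by simp)).clm_apply continuous_const).aestronglyMeasurable
  · refine Eventually.of_forall fun x => ?_
    have h1 : HasDerivAt (fun s : ℝ => S (x + s • e)) (fderiv ℝ S x e) 0 := by
      have h2 : HasDerivAt (fun s : ℝ => x + s • e) e 0 := by
        simpa using ((hasDerivAt_id (0 : ℝ)).smul_const e).const_add x
      have h3 : HasFDerivAt S (fderiv ℝ S x) (x + (0 : ℝ) • e) := by
        simpa using (hSs.differentiable (by simp) x).hasFDerivAt
      exact h3.comp_hasDerivAt 0 h2
    have h4 := h1.tendsto_slope_zero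
    have h5 : Tendsto t atTop (𝓝[≠] 0) :=
      tendsto_nhdsWithin_iff.2 ⟨htlim, Eventually.of_forall fun n => (ht0 n).ne'⟩
    simpa [Function.comp_def] using h4.comp h5
  · refine Eventually.of_forall fun n => ?_
    rw [nrm3, lpNorm_const_smul, coe_nnnorm, norm_inv, Real.norm_of_nonneg (ht0 n).le]
    have h := hA (t n • e)
    rw [norm_smul, Real.norm_of_nonneg (ht0 n).le] at h
    rw [inv_mul_le_iff₀ (ht0 n)]
    refine h.trans (le_of_eq (by ring))

end Approx

/-! ### The weights of `K`, and sums of block norms -/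

section Weights

theorem lam_rpow (q : ℤ) (a : ℝ) : lam q ^ a = (2 : ℝ) ^ ((q : ℝ) * a) := by
  rw [lam, ← Real.rpow_intCast, ← Real.rpow_mul zero_le_two]

theorem lam_pos (q : ℤ) : 0 < lam q := zpow_pos two_pos q

theorem lam_eq_rpow (q : ℤ) : lam q = (2 : ℝ) ^ (q : ℝ) := by
  rw [lam, Real.rpow_intCast]

theorem locKernel_nonneg (q : ℤ) : 0 ≤ locKernel q := by
  rw [locKernel]
  split_ifs <;> exact Real.rpow_nonneg (lam_pos q).le _

/-- For q ≥ Q the weights of K and of d_q² combine to λ_Q^{2/3}, independent of q: this is the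
unweighted ℓ² sum that controls u - S_Q u. -/
theorem locKernel_mul_of_le {q Q : ℤ} (h : Q ≤ q) :
    locKernel (Q - q) * (lam q ^ (1 / 3 : ℝ)) ^ 2 = (lam Q ^ (1 / 3 : ℝ)) ^ 2 := by
  rw [locKernel, if_pos (by omega), lam_rpow, lam_rpow, lam_rpow, ← Real.rpow_natCast,
    ← Real.rpow_mul zero_le_two, ← Real.rpow_add two_pos, ← Real.rpow_natCast,
    ← Real.rpow_mul zero_le_two]
  congr 1
  push_cast
  ring

/-- For q < Q the combined weight is λ_Q^{-4/3} λ_q², the ℓ² weight of the gradient of S_Q u. -/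
theorem locKernel_mul_of_lt {q Q : ℤ} (h : q < Q) :
    locKernel (Q - q) * (lam q ^ (1 / 3 : ℝ)) ^ 2 * (lam Q ^ (1 / 3 : ℝ)) ^ 4 = lam q ^ 2 := by
  rw [locKernel, if_neg (by omega), lam_rpow, lam_rpow, lam_rpow, lam_eq_rpow q,
    ← Real.rpow_natCast, ← Real.rpow_mul zero_le_two, ← Real.rpow_add two_pos,
    ← Real.rpow_natCast, ← Real.rpow_mul zero_le_two, ← Real.rpow_add two_pos,
    ← Real.rpow_natCast, ← Real.rpow_mul zero_le_two]
  congr 1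
  push_cast
  ring

theorem lam_rpow_third_pow (q : ℤ) : (lam q ^ (1 / 3 : ℝ)) ^ 3 = lam q := by
  rw [← Real.rpow_natCast, ← Real.rpow_mul (lam_pos q).le]
  norm_num

end Weights

section Sums

variable {χ : E3 → ℝ} (hχ : IsCutoff χ)

include hχ

theorem sum_weighted_le {u : E3 → E3} (hu : MemLp u 2) (Q : ℕ) (hL : locConv χ u Q ≠ ⊤)
    (s : Finset ℕ) :
    ∑ n ∈ s, locKernel ((Q : ℤ) - ((n : ℤ) - 1)) * (lam ((n : ℤ) - 1) ^ (1 / 3 : ℝ)) ^ 2 *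
      nrm3 (shellPart χ u n) ^ 2 ≤ (locConv χ u Q).toReal := by
  have hterm : ∀ n : ℕ, ENNReal.ofReal (locKernel ((Q : ℤ) - ((n : ℤ) - 1)) *
      (lam ((n : ℤ) - 1) ^ (1 / 3 : ℝ)) ^ 2 * nrm3 (shellPart χ u n) ^ 2) =
      ENNReal.ofReal (locKernel ((Q : ℤ) - ((n : ℤ) - 1))) * dcoef χ u ((n : ℤ) - 1) ^ 2 := by
    intro n
    have h1 : dcoef χ u ((n : ℤ) - 1) =
        ENNReal.ofReal (lam ((n : ℤ) - 1) ^ (1 / 3 : ℝ) * nrm3 (shellPart χ u n)) := by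
      rw [dcoef, ENNReal.ofReal_mul (Real.rpow_nonneg (lam_pos _).le _),
        ofReal_lpNorm (memLp_three_shellPart hχ hu n)]
    rw [h1, ← ENNReal.ofReal_pow (mul_nonneg (Real.rpow_nonneg (lam_pos _).le _) lpNorm_nonneg),
      ← ENNReal.ofReal_mul (locKernel_nonneg _), mul_pow, mul_assoc]
  have hnn : ∀ n ∈ s, 0 ≤ locKernel ((Q : ℤ) - ((n : ℤ) - 1)) *
      (lam ((n : ℤ) - 1) ^ (1 / 3 : ℝ)) ^ 2 * nrm3 (shellPart χ u n) ^ 2 := fun n _ =>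
    mul_nonneg (mul_nonneg (locKernel_nonneg _) (sq_nonneg _)) (sq_nonneg _)
  rw [← ENNReal.ofReal_le_iff_le_toReal hL, ENNReal.ofReal_sum_of_nonneg hnn]
  simp only [hterm]
  have hinj : Function.Injective fun n : ℕ => (n : ℤ) - 1 := fun a b h => by
    simpa using h
  refine le_trans (ENNReal.sum_le_tsum s) ?_
  exact ENNReal.tsum_comp_le_tsum_of_injective hinj
    fun p : ℤ => ENNReal.ofReal (locKernel (Q - p)) * dcoef χ u p ^ 2

/-- The sum starts at n = Q + 1, that is q = Q, one block below the cut at n = Q + 2, because the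
embedding involves one neighbouring block. -/
theorem sum_high_le {u : E3 → E3} (hu : MemLp u 2) (Q : ℕ) (hL : locConv χ u Q ≠ ⊤) (N : ℕ) :
    ∑ n ∈ Finset.Icc (Q + 2 - 1) N, nrm3 (shellPart χ u n) ^ 2 ≤
      (locConv χ u Q).toReal / (lam Q ^ (1 / 3 : ℝ)) ^ 2 := by
  have hpos : 0 < lam Q ^ (1 / 3 : ℝ) := Real.rpow_pos_of_pos (lam_pos _) _
  rw [le_div_iff₀ (by positivity), Finset.sum_mul]
  refine le_trans (le_of_eq (Finset.sum_congr rfl fun n hn => ?_))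
    (sum_weighted_le hχ hu Q hL (Finset.Icc (Q + 2 - 1) N))
  rw [Finset.mem_Icc] at hn
  rw [locKernel_mul_of_le (by omega)]
  ring

/-- The range reaches q = Q + 1, one block past S_Q. There 2^n ≤ 4 λ_Q, whence the constant 16; the
blocks q < Q need only 4. -/
theorem sum_low_le {u : E3 → E3} (hu : MemLp u 2) (Q : ℕ) (hL : locConv χ u Q ≠ ⊤) :
    ∑ n ∈ Finset.Icc 0 (Q + 2), ((2 : ℝ) ^ n) ^ 2 * nrm3 (shellPart χ u n) ^ 2 ≤
      16 * (lam Q ^ (1 / 3 : ℝ)) ^ 4 * (locConv χ u Q).toReal := by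
  have hpos : 0 < lam Q ^ (1 / 3 : ℝ) := Real.rpow_pos_of_pos (lam_pos _) _
  refine le_trans ?_ (mul_le_mul_of_nonneg_left
    (sum_weighted_le hχ hu Q hL (Finset.Icc 0 (Q + 2))) (by positivity))
  rw [Finset.mul_sum]
  refine Finset.sum_le_sum fun n hn => ?_
  rw [Finset.mem_Icc] at hn
  rw [← mul_assoc]
  refine mul_le_mul_of_nonneg_right ?_ (sq_nonneg _)
  have h2n : (2 : ℝ) ^ n = 2 * lam ((n : ℤ) - 1) := by
    rw [lam, zpow_sub_one₀ two_ne_zero, zpow_natCast]; field_simp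
  by_cases h : (n : ℤ) - 1 < Q
  · have := locKernel_mul_of_lt h
    have h0 := sq_nonneg (lam ((n : ℤ) - 1))
    rw [h2n]
    nlinarith
  · rw [locKernel_mul_of_le (by omega)]
    have h3 : ((2 : ℝ) ^ n) ≤ 2 ^ (Q + 2) := pow_le_pow_right₀ one_le_two hn.2
    have h4 : (2 : ℝ) ^ (Q + 2) = 4 * (lam Q ^ (1 / 3 : ℝ)) ^ 3 := by
      rw [lam_rpow_third_pow, lam, zpow_natCast]; ring
    rw [h4] at h3
    calc ((2 : ℝ) ^ n) ^ 2 ≤ (4 * (lam Q ^ (1 / 3 : ℝ)) ^ 3) ^ 2 :=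
          pow_le_pow_left₀ (by positivity) h3 2
      _ = _ := by ring

variable {F : Type*} [NormedAddCommGroup F] [NormedSpace ℝ F]

theorem partialSum_eq_lowPass {f : E3 → F}
    (hf : ∀ n x, Integrable fun y => lowKernel χ n y • f (x - y)) (Q : ℕ) :
    partialSum χ Q f = lowPass χ f (Q + 2) := by
  ext1 x
  have hb : ∀ n : ℕ, block χ ((n : ℤ) - 1) f x = lowPass χ f (n + 1) x - lowPass χ f n x := by
    intro n
    rw [block, kernel_eq_lowKernel_sub hχ]
    have := integral_sub (hf (n + 1) x) (hf n x)
    simp only [← sub_smul] at this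
    exact this
  have hidx : ∑ q ∈ Finset.Icc (-1 : ℤ) Q, block χ q f x =
      ∑ n ∈ Finset.range (Q + 2), block χ ((n : ℤ) - 1) f x := by
    symm
    refine Finset.sum_nbij (fun n : ℕ => (n : ℤ) - 1) ?_ ?_ ?_ fun _ _ => rfl
    · intro n hn
      rw [Finset.mem_range] at hn
      rw [Finset.mem_Icc]
      omega
    · intro a _ b _ h
      simpa using h
    · intro q hq
      rw [Finset.mem_coe, Finset.mem_Icc] at hq
      refine ⟨(q + 1).toNat, ?_, ?_⟩
      · rw [Finset.mem_coe, Finset.mem_range]; omega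
      · dsimp only; omega
  rw [partialSum, hidx, Finset.sum_congr rfl fun n _ => hb n,
    Finset.sum_range_sub fun n => lowPass χ f n x, lowPass_zero]
  simp

theorem integrable_lowKernel_smul {f : E3 → F} (hf : Integrable f) (n : ℕ) (x : E3) :
    Integrable fun y => lowKernel χ n y • f (x - y) := by
  obtain ⟨k, hk⟩ := exists_schwartz_lowKernel hχ n
  have hf' : Integrable fun y => f (x - y) := hf.comp_sub_left x
  rw [← hk]
  refine (hf'.norm.const_mul (SchwartzMap.seminorm ℝ 0 0 k)).mono'
    (k.continuous.aestronglyMeasurable.smul hf'.1) (Eventually.of_forall fun y => ?_)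
  rw [norm_smul]
  exact mul_le_mul_of_nonneg_right (SchwartzMap.norm_le_seminorm ℝ k y) (norm_nonneg _)

end Sums

/-! ### Covariance form and the flux estimate -/

section Flux

variable {χ : E3 → ℝ} (hχ : IsCutoff χ)

include hχ

omit hχ in
theorem memLp_coord {u : E3 → E3} {p : ℝ≥0∞} (hu : MemLp u p) (i : Fin 3) :
    MemLp (fun x => u x i) p :=
  (EuclideanSpace.proj (𝕜 := ℝ) i : E3 →L[ℝ] ℝ).comp_memLp' hu

omit hχ in
theorem integrable_coord_mul {u : E3 → E3} (hu : MemLp u 2) (i j : Fin 3) :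
    Integrable fun x => u x i * u x j :=
  (memLp_coord hu i).integrable_mul (memLp_coord hu j)

theorem lowPass_coord {u : E3 → E3} (hu : MemLp u 2) (n : ℕ) (x : E3) (i : Fin 3) :
    lowPass χ u n x i = ∫ y, lowKernel χ n y * u (x - y) i := by
  have h := (EuclideanSpace.proj (𝕜 := ℝ) i : E3 →L[ℝ] ℝ).integral_comp_comm
    (integrable_conv (memLp_lowKernel hχ n 2) hu x)
  rw [lowPass, conv_apply]
  simpa using h.symm

/-- The covariance form of the commutator `S_Q(u ⊗ u) - S_Q u ⊗ S_Q u`. -/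
theorem lowPass_mul_sub {u : E3 → E3} (hu : MemLp u 2) (n : ℕ) (x : E3) (i j : Fin 3) :
    lowPass χ (fun z => u z i * u z j) (n + 1) x =
      lowPass χ u (n + 1) x i * lowPass χ u (n + 1) x j +
      ∫ y, lowKernel χ (n + 1) y * ((u (x - y) - lowPass χ u (n + 1) x) i *
        (u (x - y) - lowPass χ u (n + 1) x) j) := by
  set S := lowPass χ u (n + 1) x with hS
  set k := lowKernel χ (n + 1) with hk
  have ik : Integrable k := integrable_lowKernel hχ _
  have ii : ∀ i, Integrable fun y => k y * u (x - y) i := fun i =>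
    integrable_conv (memLp_lowKernel hχ _ 2) (memLp_coord hu i) x
  have iij : Integrable fun y => k y * (u (x - y) i * u (x - y) j) :=
    integrable_lowKernel_smul hχ (integrable_coord_mul hu i j) (n + 1) x
  -- Mass 1 is what makes the cross terms of the covariance collapse; it fails for `lowKernel χ 0`,
  -- hence the index n + 1.
  have hk1 : ∫ y, k y = 1 := integral_dil hχ (by positivity)
  have hSi : ∀ i, ∫ y, k y * u (x - y) i = S i := fun i => (lowPass_coord hχ hu _ x i).symm
  have e : ∀ y, k y * ((u (x - y) - S) i * (u (x - y) - S) j) =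
      k y * (u (x - y) i * u (x - y) j) - S j * (k y * u (x - y) i) -
        S i * (k y * u (x - y) j) + S i * S j * k y := fun y => by
    simp only [PiLp.sub_apply]; ring
  have j1 : Integrable fun y => k y * (u (x - y) i * u (x - y) j) - S j * (k y * u (x - y) i) :=
    iij.sub ((ii i).const_mul _)
  have j2 : Integrable fun y => k y * (u (x - y) i * u (x - y) j) - S j * (k y * u (x - y) i) -
      S i * (k y * u (x - y) j) := j1.sub ((ii j).const_mul _)
  simp only [e]
  rw [integral_add j2 (ik.const_mul _), integral_sub j1 ((ii j).const_mul _),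
    integral_sub iij ((ii i).const_mul _), integral_const_mul, integral_const_mul,
    integral_const_mul, hSi, hSi, hk1]
  have : lowPass χ (fun z => u z i * u z j) (n + 1) x =
      ∫ y, k y * (u (x - y) i * u (x - y) j) := rfl
  rw [this]
  ring

theorem fluxDensity_eq {u : E3 → E3} (hu : MemLp u 2) (Q : ℕ) (x : E3) :
    fluxDensity χ Q u x = ∑ i, ∑ j, lowPass χ (fun z => u z i * u z j) (Q + 2) x *
      fderiv ℝ (lowPass χ u (Q + 2)) x (EuclideanSpace.single j 1) i := by
  rw [fluxDensity, Matrix.trace]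
  simp only [Matrix.diag_apply, Matrix.mul_apply, tensorMatrix, gradMatrix, Matrix.of_apply]
  rw [partialSum_eq_lowPass hχ fun n x => integrable_conv (memLp_lowKernel hχ n 2) hu x]
  refine Finset.sum_congr rfl fun i _ => Finset.sum_congr rfl fun j _ => ?_
  rw [partialSum_eq_lowPass hχ fun n x =>
    integrable_lowKernel_smul hχ (integrable_coord_mul hu i j) n x]

omit hχ in
theorem sum_mul_mul_apply_single (A : E3 →L[ℝ] E3) (v : E3) :
    ∑ i, ∑ j, v i * v j * A (EuclideanSpace.single j 1) i = ⟪v, A v⟫ := by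
  have hv : v = ∑ j, v j • EuclideanSpace.single j (1 : ℝ) := by
    ext i
    simp [Finset.sum_apply, Pi.single_apply]
  have hA : ∀ i, A v i = ∑ j, v j * A (EuclideanSpace.single j 1) i := fun i => by
    conv_lhs => rw [hv, map_sum]
    simp
  rw [PiLp.inner_apply]
  refine Finset.sum_congr rfl fun i _ => ?_
  rw [hA]
  simp only [RCLike.inner_apply, conj_trivial, Finset.sum_mul]
  exact Finset.sum_congr rfl fun j _ => by ring

theorem integrable_fluxDensity {u : E3 → E3} (hu : MemLp u 2) (Q : ℕ) :
    Integrable (fluxDensity χ Q u) := by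
  have e : fluxDensity χ Q u = fun x => ∑ i, ∑ j, lowPass χ (fun z => u z i * u z j) (Q + 2) x *
      fderiv ℝ (lowPass χ u (Q + 2)) x (EuclideanSpace.single j 1) i :=
    funext (fluxDensity_eq hχ hu Q)
  rw [e]
  refine integrable_finsetSum _ fun i _ => integrable_finsetSum _ fun j _ => ?_
  have h1 : Integrable (lowPass χ (fun z => u z i * u z j) (Q + 2)) :=
    memLp_one_iff_integrable.1 (memLp_convolution _ norm_lsmul_le (integrable_lowKernel hχ _)
      (memLp_one_iff_integrable.2 (integrable_coord_mul hu i j)) le_rfl (by norm_num))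
  obtain ⟨M, hM⟩ := (fderiv_lowPass hχ hu (Q + 2)).2
  have hc : Continuous fun x => fderiv ℝ (lowPass χ u (Q + 2)) x (EuclideanSpace.single j 1) i :=
    (EuclideanSpace.proj (𝕜 := ℝ) i : E3 →L[ℝ] ℝ).continuous.comp
      (((contDiff_lowPass hχ hu (Q + 2)).continuous_fderiv (by simp)).clm_apply continuous_const)
  refine h1.mul_bdd (c := M) hc.aestronglyMeasurable (Eventually.of_forall fun x => ?_)
  refine (PiLp.norm_apply_le _ _).trans ((ContinuousLinearMap.le_opNorm _ _).trans ?_)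
  simpa using hM x

/-- The flux reduces to the pairing of the commutator with the gradient. -/
theorem enorm_flux_le {u : E3 → E3} (hu : MemLp u 2) (hdiv : IsDivFree u) (Q : ℕ) :
    ‖flux χ Q u‖ₑ ≤ 3 * ∑ j : Fin 3, ∫⁻ y, ‖lowKernel χ (Q + 2) y‖ₑ *
      ∫⁻ x, ‖u (x - y) - lowPass χ u (Q + 2) x‖ₑ * ‖u (x - y) - lowPass χ u (Q + 2) x‖ₑ *
        ‖fderiv ℝ (lowPass χ u (Q + 2)) x (EuclideanSpace.single j 1)‖ₑ := by
  set S := lowPass χ u (Q + 2) with hS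
  set k := lowKernel χ (Q + 2) with hk
  set R : E3 → ℝ := fun x => ∑ i, ∑ j, (∫ y, k y * ((u (x - y) - S x) i * (u (x - y) - S x) j)) *
    fderiv ℝ S x (EuclideanSpace.single j 1) i with hR
  -- R is the covariance contribution; the other term integrates to 0 by incompressibility.
  have hsplit : ∀ x, fluxDensity χ Q u x = ⟪S x, fderiv ℝ S x (S x)⟫ + R x := fun x => by
    rw [fluxDensity_eq hχ hu, ← sum_mul_mul_apply_single, ← Finset.sum_add_distrib]
    refine Finset.sum_congr rfl fun i _ => ?_
    rw [← Finset.sum_add_distrib]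
    refine Finset.sum_congr rfl fun j _ => ?_
    rw [lowPass_mul_sub hχ hu (Q + 1) x i j, add_mul]
  have hS2 : MemLp S 2 := memLp_lowPass hχ hu _
  have hDc : Continuous (fderiv ℝ S) := (contDiff_lowPass hχ hu (Q + 2)).continuous_fderiv (by simp)
  have hSc : Continuous S := (contDiff_lowPass hχ hu (Q + 2)).continuous
  obtain ⟨M, hM⟩ := (fderiv_lowPass hχ hu (Q + 2)).2
  have i1 : Integrable fun x => ⟪S x, fderiv ℝ S x (S x)⟫ := by
    have i0 : Integrable fun x => ‖S x‖ ^ 2 := hS2.integrable_norm_pow (by norm_num)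
    refine (i0.const_mul M).mono'
      (hSc.inner (hDc.clm_apply hSc)).aestronglyMeasurable (Eventually.of_forall fun x => ?_)
    refine (norm_inner_le_norm _ _).trans ?_
    calc ‖S x‖ * ‖fderiv ℝ S x (S x)‖ ≤ ‖S x‖ * (M * ‖S x‖) := by
          gcongr
          exact ContinuousLinearMap.le_of_opNorm_le _ (hM x) _
      _ = _ := by ring
  have i2 : Integrable R := by
    have : R = fluxDensity χ Q u - fun x => ⟪S x, fderiv ℝ S x (S x)⟫ := by
      ext1 x
      rw [Pi.sub_apply, hsplit]; ring
    rw [this]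
    exact (integrable_fluxDensity hχ hu Q).sub i1
  have hflux : flux χ Q u = ∫ x, R x := by
    rw [flux]
    simp only [hsplit]
    rw [integral_add i1 i2, integral_inner_lowPass_eq_zero hχ hu hdiv, zero_add]
  have ham : AEStronglyMeasurable (fun p : E3 × E3 => u (p.1 - p.2) - S p.1)
      (volume.prod volume) := (aestronglyMeasurable_comp_sub hu.1).sub hS2.1.comp_fst
  have hkm : AEStronglyMeasurable k := (integrable_lowKernel hχ _).1
  have hcoord : ∀ (w : E3) (i : Fin 3), ‖w i‖ₑ ≤ ‖w‖ₑ := fun w i => by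
    rw [← ofReal_norm, ← ofReal_norm]
    exact ENNReal.ofReal_le_ofReal (PiLp.norm_apply_le _ _)
  -- Bounding every coordinate in i by the full norm makes the sum over i a factor 3.
  have hRle : ∀ x, ‖R x‖ₑ ≤ 3 * ∑ j : Fin 3, ∫⁻ y, ‖k y‖ₑ * (‖u (x - y) - S x‖ₑ *
      ‖u (x - y) - S x‖ₑ * ‖fderiv ℝ S x (EuclideanSpace.single j 1)‖ₑ) := fun x => by
    have h3 : (3 : ℝ≥0∞) * ∑ j : Fin 3, ∫⁻ y, ‖k y‖ₑ * (‖u (x - y) - S x‖ₑ *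
      ‖u (x - y) - S x‖ₑ * ‖fderiv ℝ S x (EuclideanSpace.single j 1)‖ₑ) =
      ∑ _i : Fin 3, ∑ j : Fin 3, ∫⁻ y, ‖k y‖ₑ * (‖u (x - y) - S x‖ₑ *
      ‖u (x - y) - S x‖ₑ * ‖fderiv ℝ S x (EuclideanSpace.single j 1)‖ₑ) := by
      simp
    rw [h3]
    refine (enorm_sum_le _ _).trans (Finset.sum_le_sum fun i _ => (enorm_sum_le _ _).trans
      (Finset.sum_le_sum fun j _ => ?_))
    rw [enorm_mul]
    calc _ ≤ (∫⁻ y, ‖k y‖ₑ * (‖u (x - y) - S x‖ₑ * ‖u (x - y) - S x‖ₑ)) *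
          ‖fderiv ℝ S x (EuclideanSpace.single j 1)‖ₑ := by
          refine mul_le_mul' ((enorm_integral_le_lintegral_enorm _).trans
            (lintegral_mono fun y => ?_)) (hcoord _ _)
          rw [enorm_mul, enorm_mul]
          gcongr <;> exact hcoord _ _
      _ = _ := by
          rw [← lintegral_mul_const' _ _ enorm_ne_top]
          simp only [mul_assoc]
  have hprod : ∀ j : Fin 3, AEMeasurable (fun p : E3 × E3 => ‖k p.2‖ₑ * (‖u (p.1 - p.2) - S p.1‖ₑ *
      ‖u (p.1 - p.2) - S p.1‖ₑ * ‖fderiv ℝ S p.1 (EuclideanSpace.single j 1)‖ₑ))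
      (volume.prod volume) := fun j => by
    have hD : AEStronglyMeasurable (fun x => fderiv ℝ S x (EuclideanSpace.single j 1)) :=
      (hDc.clm_apply continuous_const).aestronglyMeasurable
    exact hkm.enorm.comp_snd.mul ((ham.enorm.mul ham.enorm).mul hD.enorm.comp_fst)
  rw [hflux]
  calc ‖∫ x, R x‖ₑ ≤ ∫⁻ x, ‖R x‖ₑ := enorm_integral_le_lintegral_enorm _
    _ ≤ ∫⁻ x, 3 * ∑ j : Fin 3, ∫⁻ y, ‖k y‖ₑ * (‖u (x - y) - S x‖ₑ *
      ‖u (x - y) - S x‖ₑ * ‖fderiv ℝ S x (EuclideanSpace.single j 1)‖ₑ) := lintegral_mono hRle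
    _ = 3 * ∑ j : Fin 3, ∫⁻ x, ∫⁻ y, ‖k y‖ₑ * (‖u (x - y) - S x‖ₑ *
      ‖u (x - y) - S x‖ₑ * ‖fderiv ℝ S x (EuclideanSpace.single j 1)‖ₑ) := by
        rw [lintegral_const_mul' _ _ (by norm_num), lintegral_finsetSum' _
          fun j _ => (hprod j).lintegral_prod_right']
    _ = _ := by
        congr 1
        refine Finset.sum_congr rfl fun j _ => ?_
        rw [lintegral_lintegral_swap (hprod j)]
        refine lintegral_congr fun y => ?_
        rw [lintegral_const_mul' _ _ enorm_ne_top]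

/-- The flux estimate in terms of `L³` bounds for the high- and low-frequency parts. -/
theorem exists_abs_flux_le_of_bounds : ∃ C : ℝ, 0 < C ∧ ∀ u : E3 → E3, MemLp u 2 →
    IsDivFree u → ∀ (Q : ℕ) (A D : ℝ), MemLp (u - lowPass χ u (Q + 2)) 3 →
      nrm3 (u - lowPass χ u (Q + 2)) ≤ A →
      (∀ y, nrm3 (fun x => lowPass χ u (Q + 2) (x + y) - lowPass χ u (Q + 2) x) ≤ D * ‖y‖) →
      0 ≤ D → |flux χ Q u| ≤ C * D * (A ^ 2 + D ^ 2 / (2 ^ (Q + 1)) ^ 2) := by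
  obtain ⟨C, hC, hb⟩ := exists_dil_bounds hχ
  -- Nine index pairs, times the 2 from (A + D|y|)² ≤ 2A² + 2D²|y|².
  refine ⟨18 * C, by positivity, fun u hu hdiv Q A D hm hA hD hD0 => ?_⟩
  have ht : (0 : ℝ) < 2 ^ (Q + 1) := by positivity
  set S := lowPass χ u (Q + 2) with hS
  have hS3 : MemLp S 3 := memLp_three_lowPass hχ hu _
  have hA0 : 0 ≤ A := lpNorm_nonneg.trans hA
  have hD' : ∀ j : Fin 3, MemLp (fun x => fderiv ℝ S x (EuclideanSpace.single j 1)) 3 ∧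
      nrm3 (fun x => fderiv ℝ S x (EuclideanSpace.single j 1)) ≤ D := fun j => by
    simpa using nrm3_fderiv_lowPass_le hχ hu (Q + 2) hD (EuclideanSpace.single j 1)
  have ha : ∀ y, MemLp (fun x => u (x - y) - S x) 3 ∧
      nrm3 (fun x => u (x - y) - S x) ≤ A + D * ‖y‖ := fun y => by
    -- The increment is the translated high-frequency part plus a translation difference of S,
    -- bounded by A and D|y| respectively.
    have e : (fun x => u (x - y) - S x) =
        (fun x => (u - S) (x - y)) + fun x => S (x + -y) - S x := by
      ext1 x
      simp only [Pi.add_apply, Pi.sub_apply, ← sub_eq_add_neg]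
      abel
    have m1 : MemLp (fun x => (u - S) (x - y)) 3 := hm.comp_sub_const y
    have m2 : MemLp (fun x => S (x + -y) - S x) 3 := (hS3.comp_add_const _).sub hS3
    rw [e]
    refine ⟨m1.add m2, (lpNorm_add_le m1 (by norm_num)).trans (add_le_add ?_ ?_)⟩
    · rw [lpNorm_comp_sub_const hm.1]; exact hA
    · simpa using hD (-y)
  have hki := integrable_dil hχ ht
  have hk2 := integrable_pow_mul_dil hχ ht 2
  have hi : Integrable fun y => 2 * A ^ 2 * D * |dil χ (2 ^ (Q + 1)) y| +
      2 * D ^ 3 * (‖y‖ ^ 2 * |dil χ (2 ^ (Q + 1)) y|) :=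
    (hki.abs.const_mul _).add (hk2.const_mul _)
  have hint : ∀ j : Fin 3, ∫⁻ y, ‖lowKernel χ (Q + 2) y‖ₑ *
      ∫⁻ x, ‖u (x - y) - S x‖ₑ * ‖u (x - y) - S x‖ₑ *
        ‖fderiv ℝ S x (EuclideanSpace.single j 1)‖ₑ ≤
      ENNReal.ofReal (2 * C * D * (A ^ 2 + D ^ 2 / (2 ^ (Q + 1)) ^ 2)) := fun j => by
    calc _ ≤ ∫⁻ y, ENNReal.ofReal (2 * A ^ 2 * D * |dil χ (2 ^ (Q + 1)) y| +
          2 * D ^ 3 * (‖y‖ ^ 2 * |dil χ (2 ^ (Q + 1)) y|)) := by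
          refine lintegral_mono fun y => ?_
          obtain ⟨m1, h1⟩ := ha y
          refine (mul_le_mul_right (lintegral_mul_mul_le m1 m1 (hD' j).1) _).trans ?_
          rw [lowKernel_succ, ← ofReal_norm, ← ENNReal.ofReal_mul (norm_nonneg _)]
          refine ENNReal.ofReal_le_ofReal ?_
          have n1 : 0 ≤ nrm3 (fun x => u (x - y) - S x) := lpNorm_nonneg
          have h2 : nrm3 (fun x => u (x - y) - S x) * nrm3 (fun x => u (x - y) - S x) *
              nrm3 (fun x => fderiv ℝ S x (EuclideanSpace.single j 1)) ≤
              (2 * A ^ 2 + 2 * D ^ 2 * ‖y‖ ^ 2) * D := by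
            refine mul_le_mul ?_ (hD' j).2 lpNorm_nonneg (by positivity)
            nlinarith [mul_le_mul h1 h1 n1 (n1.trans h1), sq_nonneg (A - D * ‖y‖)]
          calc _ ≤ ‖dil χ (2 ^ (Q + 1)) y‖ * ((2 * A ^ 2 + 2 * D ^ 2 * ‖y‖ ^ 2) * D) :=
                mul_le_mul_of_nonneg_left h2 (norm_nonneg _)
            _ = _ := by rw [Real.norm_eq_abs]; ring
      _ = ENNReal.ofReal (∫ y, (2 * A ^ 2 * D * |dil χ (2 ^ (Q + 1)) y| +
          2 * D ^ 3 * (‖y‖ ^ 2 * |dil χ (2 ^ (Q + 1)) y|))) :=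
          (ofReal_integral_eq_lintegral_ofReal hi
            (Eventually.of_forall fun y => by positivity)).symm
      _ ≤ _ := by
          refine ENNReal.ofReal_le_ofReal ?_
          rw [integral_add (hki.abs.const_mul _) (hk2.const_mul _), integral_const_mul,
            integral_const_mul]
          have h1 := (hb _ ht).1
          have h2 := (hb _ ht).2.2.1
          calc _ ≤ 2 * A ^ 2 * D * C + 2 * D ^ 3 * (C / (2 ^ (Q + 1)) ^ 2) := by gcongr
            _ = _ := by ring
  have hX0 : 0 ≤ 2 * C * D * (A ^ 2 + D ^ 2 / (2 ^ (Q + 1)) ^ 2) := by positivity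
  have h := (enorm_flux_le hχ hu hdiv Q).trans (mul_le_mul_right
    (Finset.sum_le_sum fun j _ => hint j) _)
  rw [Finset.sum_const, Finset.card_univ, Fintype.card_fin, ← ofReal_norm, Real.norm_eq_abs,
    nsmul_eq_mul, ← mul_assoc] at h
  have h9 : (3 : ℝ≥0∞) * ((3 : ℕ) : ℝ≥0∞) = ENNReal.ofReal 9 := by
    rw [ENNReal.ofReal_ofNat]; norm_num
  rw [h9, ← ENNReal.ofReal_mul (by norm_num), ENNReal.ofReal_le_ofReal_iff (by positivity)] at h
  refine h.trans (le_of_eq (by ring))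

end Flux

end LittlewoodPaley

end

/-! ### Assembly of the estimate -/

theorem mainTheorem2 (χ : LittlewoodPaley.E3 → ℝ) (hχ : LittlewoodPaley.IsCutoff χ) :
    ∃ C : ℝ, 0 < C ∧
      ∀ u : LittlewoodPaley.E3 → LittlewoodPaley.E3,
        MemLp u 2 volume → LittlewoodPaley.IsDivFree u →
        ∀ Q : ℕ,
          Differentiable ℝ (LittlewoodPaley.partialSum χ Q u) ∧
          Integrable (LittlewoodPaley.fluxDensity χ Q u) volume ∧
          ENNReal.ofReal |LittlewoodPaley.flux χ Q u| ≤
            ENNReal.ofReal C * LittlewoodPaley.locConv χ u Q ^ (3 / 2 : ℝ) := by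
  obtain ⟨C₁, hC₁, hhigh⟩ := LittlewoodPaley.exists_nrm3_sub_lowPass_le hχ
  obtain ⟨C₂, hC₂, hlow⟩ := LittlewoodPaley.exists_nrm3_lowPass_translate_le hχ
  obtain ⟨C, hC, hflux⟩ := LittlewoodPaley.exists_abs_flux_le_of_bounds hχ
  have hK : 0 < C * C₂ * 4 * (C₁ ^ 2 + 4 * C₂ ^ 2) := by positivity
  refine ⟨_, hK, fun u hu hdiv Q =>
    ⟨?_, LittlewoodPaley.integrable_fluxDensity hχ hu Q, ?_⟩⟩
  · rw [LittlewoodPaley.partialSum_eq_lowPass hχ fun n x =>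
      LittlewoodPaley.integrable_conv (LittlewoodPaley.memLp_lowKernel hχ n 2) hu x]
    exact (LittlewoodPaley.contDiff_lowPass hχ hu _).differentiable (by simp)
  -- If the convolution is infinite, positivity of the constant makes the right-hand side ⊤.
  · by_cases hL : LittlewoodPaley.locConv χ u Q = ⊤
    · rw [hL, ENNReal.top_rpow_of_pos (by norm_num),
        ENNReal.mul_top (ENNReal.ofReal_pos.2 hK).ne']
      exact le_top
    set L := (LittlewoodPaley.locConv χ u Q).toReal with hLdef
    have hL0 : 0 ≤ L := ENNReal.toReal_nonneg
    set l := LittlewoodPaley.lam Q ^ (1 / 3 : ℝ) with hl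
    have hl0 : 0 < l := Real.rpow_pos_of_pos (LittlewoodPaley.lam_pos _) _
    have hl3 : (2 : ℝ) ^ (Q + 1) = 2 * l ^ 3 := by
      rw [hl, LittlewoodPaley.lam_rpow_third_pow, LittlewoodPaley.lam, zpow_natCast]; ring
    obtain ⟨hm, hA⟩ := hhigh u hu (Q + 2) _ (LittlewoodPaley.sum_high_le hχ hu Q hL)
    have hD := hlow u hu (Q + 2) _ (LittlewoodPaley.sum_low_le hχ hu Q hL)
    have hfin := hflux u hu hdiv Q _ _ hm hA hD (by positivity)
    have hs1 : √(L / l ^ 2) ^ 2 = L / l ^ 2 := Real.sq_sqrt (by positivity)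
    have hs2 : √(16 * l ^ 4 * L) = 4 * l ^ 2 * √L := by
      rw [Real.sqrt_mul (by positivity)]
      congr 1
      rw [show 16 * l ^ 4 = (4 * l ^ 2) ^ 2 by ring, Real.sqrt_sq (by positivity)]
    have hsL : √L ^ 2 = L := Real.sq_sqrt hL0
    have hL32 : L ^ (3 / 2 : ℝ) = L * √L := by
      rw [Real.sqrt_eq_rpow, show (3 / 2 : ℝ) = 1 + 1 / 2 by norm_num,
        Real.rpow_add' hL0 (by norm_num), Real.rpow_one]
    have hreal : |LittlewoodPaley.flux χ Q u| ≤
        C * C₂ * 4 * (C₁ ^ 2 + 4 * C₂ ^ 2) * L ^ (3 / 2 : ℝ) := by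
      -- With l = λ_Q^{1/3}, D is 4 C₂ l² √L, while A² and D²/(2 l³)² are C₁² L/l² and 4 C₂² L/l²;
      -- the powers of l cancel.
      refine hfin.trans (le_of_eq ?_)
      rw [← hLdef, ← hl, hs2, hl3, hL32, mul_pow C₁, hs1]
      have e : (C₂ * (4 * l ^ 2 * √L)) ^ 2 = 16 * C₂ ^ 2 * l ^ 4 * L := by
        rw [mul_pow, mul_pow, hsL]; ring
      rw [e]
      field_simp
      ring
    rw [← ENNReal.ofReal_toReal hL, ENNReal.ofReal_rpow_of_nonneg ENNReal.toReal_nonneg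
      (by norm_num),
      ← ENNReal.ofReal_mul hK.le]
    exact ENNReal.ofReal_le_ofReal hreal
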